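/- **Setting.** Let $X$ and $U$ be complex separable Hilbert spaces, and assume the following. * $(A_1)$ $A:D(A)\subset X\to X$ generates a $C_0$-semigroup $S(\cdot)$ on $X$ such that $S(t)$ is compact for every $t>0$. * $(A_2)$ $B\in\mathcal L(U;X_{-1})$. Here $\rho_0\in\rho(A)\cap\mathbb R$ is fixed, and $X_{-1}$ is the completion of $X$ for the norm $\|f\|_{-1}=\|(\rho_0I-A)^{-1}f\|_X$. * $(A_3)$ There are constants $T>0$ and $C>0$ such that $\int_0^T\|B^*S^*(t)\psi\|_U^2\,dt\le C\|\psi\|_X^2$ for all $\psi\in D(A^*)$. Here $B^*:D(A^*)\to U$ is the adjoint of $B$ with respect to the duality between $X_{-1}$ and $D(A^*)$ with pivot space $X$. Let $\widetilde S(\cdot)$ be the continuous extension of $S(\cdot)$ to $X_{-1}$. That is, $\widetilde S(t)=(\rho_0I-\widetilde A)S(t)(\rho_0I-\widetilde A)^{-1}$, where $\widetilde A\in\mathcal L(X;X_{-1})$ is the continuous extension of $A$. **Proposition.** Let $\tau>0$, $E\in\mathcal L(X)$ and $F\in\mathcal L(X\times L^2(-\tau,0;X);U)$. Then for every $y_0\in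 X$ and every $\varphi\in L^2(-\tau,0;X)$, the delayed system $$y'(t)=Ay(t)+Ey(t-\tau)+BF(y(t),y(t+\cdot))\ (t>0),\qquad y(0)=y_0,\qquad y=\varphi\ \text{on }(-\tau,0),$$ has a unique mild solution in $C([0,\infty);X)$. That is, there is exactly one $y\in C([0,\infty);X)$ which, when extended by $y=\varphi$ on $(-\tau,0)$, satisfies $y(0)=y_0$ and, for all $t\ge0$, $$y(t)=S(t)y_0+\int_0^tS(t-s)Ey(s-\tau)\,ds+\int_0^t\widetilde S(t-s)BF\big(y(s),y(s+\cdot)\big)\,ds .$$ The first integral is a Bochner integral in $X$ and the second is a Bochner integral in $X_{-1}$; both exist, and the identity is read in $X_{-1}\supset X$. -/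

import Mathlib

open MeasureTheory Filter Topology Set
open scoped NNReal ENNReal

noncomputable section

namespace DelaySystem

variable {X U : Type*}

/-- A strongly continuous (`C₀`-) semigroup of bounded linear operators, indexed by `t ≥ 0`. -/
structure C0Semigroup (X : Type*) [NormedAddCommGroup X] [InnerProductSpace ℂ X] where
  /-- the operators `S(t)` -/
  op : ℝ≥0 → X →L[ℂ] X
  op_zero : op 0 = ContinuousLinearMap.id ℂ X
  op_add : ∀ s t : ℝ≥0, op (s + t) = (op s).comp (op t)
  continuous_orbit : ∀ x : X, Continuous fun t : ℝ≥0 => op t x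

section Semigroup

variable [NormedAddCommGroup X] [InnerProductSpace ℂ X]

/-- `A` (with its domain) is the infinitesimal generator of `S`: `x ∈ D(A)` and `A x = y` exactly
when `(S(h) x - x) / h → y` as `h → 0⁺`. -/
def IsGenerator (S : C0Semigroup X) (A : X →ₗ.[ℂ] X) : Prop :=
  ∀ x y : X, (x, y) ∈ A.graph ↔
    Tendsto (fun h : ℝ≥0 => (h : ℝ)⁻¹ • (S.op h x - x)) (𝓝[>] 0) (𝓝 y)

/-- `S(t)` is compact for every `t > 0`. -/
def ImmediatelyCompact (S : C0Semigroup X) : Prop :=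
  ∀ t : ℝ≥0, 0 < t → IsCompactOperator (S.op t)

/-- `R` is a bounded two-sided inverse of `z I - A : D(A) → X`. -/
def IsResolventAt (A : X →ₗ.[ℂ] X) (z : ℂ) (R : X →L[ℂ] X) : Prop :=
  (∀ f : X, ∃ x : A.domain, (x : X) = R f ∧ z • (x : X) - A x = f) ∧
    ∀ x : A.domain, R (z • (x : X) - A x) = x

/-- The resolvent set `ρ(A)` of an unbounded operator. -/
def resolventSetOf (A : X →ₗ.[ℂ] X) : Set ℂ := {z | ∃ R : X →L[ℂ] X, IsResolventAt A z R}

open scoped Classical in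
/-- The resolvent `(z I - A)⁻¹` for `z ∈ ρ(A)` (and `0` off the resolvent set). -/
def resolventOf (A : X →ₗ.[ℂ] X) (z : ℂ) : X →L[ℂ] X :=
  if h : z ∈ resolventSetOf A then Classical.choose h else 0

theorem isResolventAt_resolventOf {A : X →ₗ.[ℂ] X} {z : ℂ} (hz : z ∈ resolventSetOf A) :
    IsResolventAt A z (resolventOf A z) := by
  rw [resolventOf, dif_pos hz]
  exact Classical.choose_spec hz

theorem IsGenerator.graph_op {S : C0Semigroup X} {A : X →ₗ.[ℂ] X} (hA : IsGenerator S A)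
    (t : ℝ≥0) {x y : X} (h : (x, y) ∈ A.graph) : (S.op t x, S.op t y) ∈ A.graph := by
  rw [hA] at h ⊢
  refine (((S.op t).continuous.tendsto y).comp h).congr fun k => ?_
  have h1 : S.op t (S.op k x) = S.op k (S.op t x) := by
    rw [← ContinuousLinearMap.comp_apply, ← ContinuousLinearMap.comp_apply, ← S.op_add,
      ← S.op_add, add_comm]
  simp only [Function.comp_apply]
  rw [← Complex.coe_smul, ← Complex.coe_smul, map_smul, map_sub, h1]

/-- `S(t)` commutes with the resolvent of its generator. -/
theorem IsGenerator.resolventOf_op {S : C0Semigroup X} {A : X →ₗ.[ℂ] X} (hA : IsGenerator S A)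
    {z : ℂ} (hz : z ∈ resolventSetOf A) (t : ℝ≥0) (f : X) :
    resolventOf A z (S.op t f) = S.op t (resolventOf A z f) := by
  obtain ⟨h1, h2⟩ := isResolventAt_resolventOf hz
  obtain ⟨x, hx, hxf⟩ := h1 f
  have hg := hA.graph_op t (A.mem_graph x)
  obtain ⟨w, hw, hAw⟩ := (LinearPMap.mem_graph_iff A).1 hg
  simp only at hw hAw
  have := h2 w
  rw [hw, hAw, ← map_smul, ← map_sub, hxf] at this
  rw [this, hx]

variable [CompleteSpace X]

/-- The generator of a `C₀`-semigroup is densely defined. -/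
theorem IsGenerator.dense_domain {S : C0Semigroup X} {A : X →ₗ.[ℂ] X} (hA : IsGenerator S A) :
    Dense (A.domain : Set X) := by
  intro x
  set g : ℝ → X := fun s => S.op s.toNNReal x with hg
  have hgc : Continuous g := (S.continuous_orbit x).comp continuous_real_toNNReal
  set G : ℝ → X := fun r => ∫ s in (0 : ℝ)..r, g s with hG
  have hder : ∀ r, HasDerivAt G (g r) r := fun r => by
    exact (hgc.integral_hasStrictDerivAt 0 r).hasDerivAt
  have hlim : Tendsto (fun h : ℝ≥0 => (h : ℝ)) (𝓝[>] 0) (𝓝[≠] 0) := by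
    refine tendsto_nhdsWithin_iff.2 ⟨?_, ?_⟩
    · exact (NNReal.continuous_coe.tendsto 0).mono_left nhdsWithin_le_nhds
    · filter_upwards [self_mem_nhdsWithin] with h hh
      exact fun h0 => (ne_of_gt (show (0 : ℝ≥0) < h from hh)) (NNReal.coe_eq_zero.1 h0)
  have hslope : ∀ r, Tendsto (fun h : ℝ≥0 => (h : ℝ)⁻¹ • (G (r + h) - G r)) (𝓝[>] 0)
      (𝓝 (g r)) := fun r => (hasDerivAt_iff_tendsto_slope_zero.1 (hder r)).comp hlim
  have hmem : ∀ h : ℝ≥0, G h ∈ A.domain := by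
    intro h
    have key : (G h, g h - g 0) ∈ A.graph := by
      rw [hA]
      refine ((hslope h).sub (hslope 0)).congr fun k => ?_
      rw [← smul_sub]
      congr 1
      have e1 : S.op k (G h) = ∫ s in (k : ℝ)..(h + k), g s := by
        rw [hG]
        simp only
        rw [← ContinuousLinearMap.intervalIntegral_comp_comm _ (hgc.intervalIntegrable _ _)]
        rw [show (k : ℝ) = 0 + k by simp, show (h : ℝ) + (0 + k) = h + k by simp,
          ← intervalIntegral.integral_comp_add_right (f := g)]
        refine intervalIntegral.integral_congr fun s hs => ?_
        rw [uIcc_of_le h.coe_nonneg] at hs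
        simp only [hg]
        rw [Real.toNNReal_add hs.1 k.coe_nonneg, Real.toNNReal_coe, add_comm, S.op_add]
        rfl
      have e2 : G (h + k) - G k = ∫ s in (k : ℝ)..(h + k), g s :=
        intervalIntegral.integral_interval_sub_left (hgc.intervalIntegrable _ _)
          (hgc.intervalIntegrable _ _)
      have e3 : G 0 = 0 := by simp [hG]
      rw [e1, ← e2, e3, zero_add]
      abel
    exact LinearPMap.mem_domain_of_mem_graph key
  have h0 : Tendsto (fun h : ℝ≥0 => (h : ℝ)⁻¹ • G h) (𝓝[>] 0) (𝓝 x) := by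
    have e3 : G 0 = 0 := by simp [hG]
    have e4 : g 0 = x := by simp [hg, S.op_zero]
    have := hslope 0
    simpa only [zero_add, e3, sub_zero, e4] using this
  refine mem_closure_of_tendsto h0 (Eventually.of_forall fun h => ?_)
  rw [← Complex.coe_smul]
  exact A.domain.smul_mem _ (hmem h)

/-- `S*(t)` maps `D(A*)` to itself. -/
theorem IsGenerator.adjoint_op_mem {S : C0Semigroup X} {A : X →ₗ.[ℂ] X} (hA : IsGenerator S A)
    (t : ℝ≥0) (ψ : A.adjoint.domain) :
    ContinuousLinearMap.adjoint (S.op t) (ψ : X) ∈ A.adjoint.domain := by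
  refine LinearPMap.mem_adjoint_domain_of_exists _
    ⟨ContinuousLinearMap.adjoint (S.op t) (A.adjoint ψ), fun x => ?_⟩
  obtain ⟨w, hw, hAw⟩ := (LinearPMap.mem_graph_iff A).1 (hA.graph_op t (A.mem_graph x))
  simp only at hw hAw
  have h := LinearPMap.adjoint_isFormalAdjoint hA.dense_domain ψ w
  rw [hw, hAw] at h
  rw [ContinuousLinearMap.adjoint_inner_left, ContinuousLinearMap.adjoint_inner_left, h]

end Semigroup

section Extrapolation

variable [NormedAddCommGroup X] [InnerProductSpace ℂ X]

/-- The vector space `X`, to be equipped with the norm `f ↦ ‖(ρ₀ I - A)⁻¹ f‖`. -/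
def NegOneCarrier (_A : X →ₗ.[ℂ] X) (_ρ₀ : ℝ) : Type _ := X

instance (A : X →ₗ.[ℂ] X) (ρ₀ : ℝ) : AddCommGroup (NegOneCarrier A ρ₀) :=
  inferInstanceAs (AddCommGroup X)

instance (A : X →ₗ.[ℂ] X) (ρ₀ : ℝ) : Module ℂ (NegOneCarrier A ρ₀) :=
  inferInstanceAs (Module ℂ X)

/-- `(ρ₀ I - A)⁻¹` as a linear map on the carrier. -/
def carrierResolvent (A : X →ₗ.[ℂ] X) (ρ₀ : ℝ) : NegOneCarrier A ρ₀ →ₗ[ℂ] X :=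
  (resolventOf A (ρ₀ : ℂ)).toLinearMap

/-- The norm `‖f‖₋₁ = ‖(ρ₀ I - A)⁻¹ f‖`. -/
instance (A : X →ₗ.[ℂ] X) (ρ₀ : ℝ) : SeminormedAddCommGroup (NegOneCarrier A ρ₀) :=
  SeminormedAddCommGroup.induced (NegOneCarrier A ρ₀) X (carrierResolvent A ρ₀)

instance (A : X →ₗ.[ℂ] X) (ρ₀ : ℝ) : NormedSpace ℂ (NegOneCarrier A ρ₀) :=
  NormedSpace.induced ℂ (NegOneCarrier A ρ₀) X (carrierResolvent A ρ₀)

/-- The extrapolation space `X₋₁`: the completion of `X` for `‖f‖₋₁ = ‖(ρ₀ I - A)⁻¹ f‖`. -/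
abbrev XNegOne (A : X →ₗ.[ℂ] X) (ρ₀ : ℝ) : Type _ :=
  UniformSpace.Completion (NegOneCarrier A ρ₀)

/-- The canonical map `X → X₋₁`. -/
def toNegOne (A : X →ₗ.[ℂ] X) (ρ₀ : ℝ) (x : X) : XNegOne A ρ₀ :=
  UniformSpace.Completion.coe' (show NegOneCarrier A ρ₀ from x)

/-- The resolvent as a linear isometry from `(X, ‖·‖₋₁)` to `X`. -/
def carrierIsometry (A : X →ₗ.[ℂ] X) (ρ₀ : ℝ) : NegOneCarrier A ρ₀ →ₗᵢ[ℂ] X where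
  toLinearMap := carrierResolvent A ρ₀
  norm_map' := fun _ => rfl

variable [CompleteSpace X]

/-- The extension by continuity of `(ρ₀ I - A)⁻¹` to `X₋₁`, that is `(ρ₀ I - Ã)⁻¹ : X₋₁ → X`,
where `Ã : X → X₋₁` is the continuous extension of `A`. It is isometric. -/
def negOneIsometry (A : X →ₗ.[ℂ] X) (ρ₀ : ℝ) : XNegOne A ρ₀ →ₗᵢ[ℂ] X where
  toLinearMap :=
    ((carrierIsometry A ρ₀).toContinuousLinearMap.extend
      (UniformSpace.Completion.toComplL (𝕜 := ℂ) (E := NegOneCarrier A ρ₀))).toLinearMap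
  norm_map' := fun f => by
    have hcoe : ∀ x : NegOneCarrier A ρ₀,
        ((carrierIsometry A ρ₀).toContinuousLinearMap.extend
          (UniformSpace.Completion.toComplL (𝕜 := ℂ) (E := NegOneCarrier A ρ₀)))
          (x : UniformSpace.Completion (NegOneCarrier A ρ₀)) = carrierIsometry A ρ₀ x := fun x =>
      ContinuousLinearMap.extend_eq _ (UniformSpace.Completion.denseRange_coe)
        (UniformSpace.Completion.isUniformInducing_coe _) x
    refine UniformSpace.Completion.induction_on f ?_ fun x => ?_
    · exact isClosed_eq (ContinuousLinearMap.continuous _).norm continuous_norm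
    · rw [UniformSpace.Completion.norm_coe]
      exact (congrArg norm (hcoe x)).trans ((carrierIsometry A ρ₀).norm_map x)

theorem negOneIsometry_toNegOne (A : X →ₗ.[ℂ] X) (ρ₀ : ℝ) (x : X) :
    negOneIsometry A ρ₀ (toNegOne A ρ₀ x) = resolventOf A (ρ₀ : ℂ) x :=
  ContinuousLinearMap.extend_eq (carrierIsometry A ρ₀).toContinuousLinearMap
    (e := UniformSpace.Completion.toComplL (𝕜 := ℂ) (E := NegOneCarrier A ρ₀))
    (UniformSpace.Completion.denseRange_coe)
    (UniformSpace.Completion.isUniformInducing_coe _) (show NegOneCarrier A ρ₀ from x)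

theorem negOneIsometry_surjective {S : C0Semigroup X} {A : X →ₗ.[ℂ] X} {ρ₀ : ℝ}
    (hA : IsGenerator S A) (hρ : (ρ₀ : ℂ) ∈ resolventSetOf A) :
    Function.Surjective (negOneIsometry A ρ₀) := by
  have hcl : IsClosed (range (negOneIsometry A ρ₀)) :=
    (negOneIsometry A ρ₀).isometry.isClosedEmbedding.isClosed_range
  have hsub : (A.domain : Set X) ⊆ range (negOneIsometry A ρ₀) := fun x hx =>
    ⟨toNegOne A ρ₀ ((ρ₀ : ℂ) • x - A ⟨x, hx⟩), by
      rw [negOneIsometry_toNegOne]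
      exact (isResolventAt_resolventOf hρ).2 ⟨x, hx⟩⟩
  intro x
  exact hcl.closure_subset_iff.2 hsub (hA.dense_domain x)

/-- The isometric isomorphism `(ρ₀ I - Ã)⁻¹ : X₋₁ → X`. -/
def negOneEquiv {S : C0Semigroup X} {A : X →ₗ.[ℂ] X} {ρ₀ : ℝ}
    (hA : IsGenerator S A) (hρ : (ρ₀ : ℂ) ∈ resolventSetOf A) : XNegOne A ρ₀ ≃ₗᵢ[ℂ] X :=
  LinearIsometryEquiv.ofSurjective (negOneIsometry A ρ₀) (negOneIsometry_surjective hA hρ)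

/-- The extended semigroup `S̃(t) = (ρ₀ I - Ã) S(t) (ρ₀ I - Ã)⁻¹` on `X₋₁`. -/
def extendedSemigroup {S : C0Semigroup X} {A : X →ₗ.[ℂ] X} {ρ₀ : ℝ}
    (hA : IsGenerator S A) (hρ : (ρ₀ : ℂ) ∈ resolventSetOf A) (t : ℝ≥0) :
    XNegOne A ρ₀ →L[ℂ] XNegOne A ρ₀ :=
  ((negOneEquiv hA hρ).symm.toContinuousLinearEquiv : X →L[ℂ] XNegOne A ρ₀).comp
    ((S.op t).comp ((negOneEquiv hA hρ).toContinuousLinearEquiv : XNegOne A ρ₀ →L[ℂ] X))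

/-- `S̃(t)` extends `S(t)`. -/
theorem extendedSemigroup_toNegOne {S : C0Semigroup X} {A : X →ₗ.[ℂ] X} {ρ₀ : ℝ}
    (hA : IsGenerator S A) (hρ : (ρ₀ : ℂ) ∈ resolventSetOf A) (t : ℝ≥0) (x : X) :
    extendedSemigroup hA hρ t (toNegOne A ρ₀ x) = toNegOne A ρ₀ (S.op t x) := by
  apply (negOneEquiv hA hρ).injective
  have h1 : ∀ z, negOneEquiv hA hρ (toNegOne A ρ₀ z) = resolventOf A (ρ₀ : ℂ) z :=
    negOneIsometry_toNegOne A ρ₀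
  have h2 : negOneEquiv hA hρ (extendedSemigroup hA hρ t (toNegOne A ρ₀ x)) =
      S.op t (negOneEquiv hA hρ (toNegOne A ρ₀ x)) :=
    (negOneEquiv hA hρ).apply_symm_apply _
  rw [h2, h1, h1, hA.resolventOf_op hρ]

/-- The duality pairing `⟨f, ψ⟩` of `f ∈ X₋₁` and `ψ ∈ D(A*)` with pivot space `X`, namely
`⟨(ρ₀ I - Ã)⁻¹ f, (ρ₀ I - A*) ψ⟩_X`. (In Mathlib the inner product is linear in its second
argument.) -/
def dualPairing (A : X →ₗ.[ℂ] X) (ρ₀ : ℝ) (f : XNegOne A ρ₀) (ψ : A.adjoint.domain) : ℂ :=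
  inner ℂ ((ρ₀ : ℂ) • (ψ : X) - A.adjoint ψ) (negOneIsometry A ρ₀ f)

/-- On `X` the duality pairing is the inner product of `X`. -/
theorem dualPairing_toNegOne {S : C0Semigroup X} {A : X →ₗ.[ℂ] X} {ρ₀ : ℝ}
    (hA : IsGenerator S A) (hρ : (ρ₀ : ℂ) ∈ resolventSetOf A) (x : X) (ψ : A.adjoint.domain) :
    dualPairing A ρ₀ (toNegOne A ρ₀ x) ψ = inner ℂ (ψ : X) x := by
  obtain ⟨w, hw, hwx⟩ := (isResolventAt_resolventOf hρ).1 x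
  have h := LinearPMap.adjoint_isFormalAdjoint hA.dense_domain ψ w
  rw [dualPairing, negOneIsometry_toNegOne, ← hw, inner_sub_left, h, inner_smul_left,
    Complex.conj_ofReal, ← inner_smul_right, ← inner_sub_right, hwx]

variable [NormedAddCommGroup U] [InnerProductSpace ℂ U] [CompleteSpace U]

/-- The adjoint `B* : D(A*) → U` of `B : U → X₋₁`, where `X₋₁` is the dual of `D(A*)` with respect
to the pivot space `X`; it is characterized by `inner_controlAdjoint`. -/
def controlAdjoint {A : X →ₗ.[ℂ] X} {ρ₀ : ℝ} (B : U →L[ℂ] XNegOne A ρ₀)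
    (ψ : A.adjoint.domain) : U :=
  ContinuousLinearMap.adjoint ((negOneIsometry A ρ₀).toContinuousLinearMap.comp B)
    ((ρ₀ : ℂ) • (ψ : X) - A.adjoint ψ)

theorem inner_controlAdjoint {A : X →ₗ.[ℂ] X} {ρ₀ : ℝ} (B : U →L[ℂ] XNegOne A ρ₀)
    (ψ : A.adjoint.domain) (u : U) :
    inner ℂ (controlAdjoint B ψ) u = dualPairing A ρ₀ (B u) ψ := by
  rw [controlAdjoint, ContinuousLinearMap.adjoint_inner_left]
  rfl

/-- `B` is an admissible control operator: for some `T > 0` and `C > 0`,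
`∫₀ᵀ ‖B* S*(t) ψ‖² dt ≤ C ‖ψ‖²` for all `ψ ∈ D(A*)`. -/
def IsAdmissible {S : C0Semigroup X} {A : X →ₗ.[ℂ] X} {ρ₀ : ℝ} (hA : IsGenerator S A)
    (B : U →L[ℂ] XNegOne A ρ₀) : Prop :=
  ∃ T : ℝ, 0 < T ∧ ∃ C : ℝ, 0 < C ∧ ∀ ψ : A.adjoint.domain,
    ∫⁻ t in Ioo 0 T, ‖controlAdjoint B ⟨ContinuousLinearMap.adjoint (S.op t.toNNReal) (ψ : X),
      hA.adjoint_op_mem t.toNNReal ψ⟩‖ₑ ^ 2 ≤ ENNReal.ofReal (C * ‖(ψ : X)‖ ^ 2)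

end Extrapolation

section Delay

variable [NormedAddCommGroup X]

/-- The space `L²(-τ, 0; X)`. -/
abbrev HistorySpace (X : Type*) [NormedAddCommGroup X] (τ : ℝ) : Type _ :=
  Lp X 2 (volume.restrict (Ioo (-τ) 0))

/-- The function on `(-τ, ∞)` equal to `φ` on `(-τ, 0)` and to `y` on `[0, ∞)`. -/
def trajectory {τ : ℝ} (φ : HistorySpace X τ) (y : C(ℝ≥0, X)) (t : ℝ) : X :=
  if t < 0 then φ t else y t.toNNReal

/-- The history `θ ↦ y(t + θ)` is square integrable on `(-τ, 0)` for every `t ≥ 0`. -/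
theorem memLp_trajectory {τ : ℝ} (φ : HistorySpace X τ) (y : C(ℝ≥0, X)) (t : ℝ≥0) :
    MemLp (fun θ : ℝ => trajectory φ y (t + θ)) 2 (volume.restrict (Ioo (-τ) 0)) := by
  have hmp : MeasurePreserving (fun θ : ℝ => (t : ℝ) + θ) volume volume :=
    measurePreserving_add_left volume (t : ℝ)
  have h1 : MemLp (fun θ : ℝ => (Ioo (-τ) 0).indicator (fun s => φ s) (t + θ)) 2
      (volume : Measure ℝ) := by
    have : MemLp ((Ioo (-τ) 0).indicator (fun s => φ s)) 2 (volume : Measure ℝ) :=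
      (memLp_indicator_iff_restrict measurableSet_Ioo).2 (Lp.memLp φ)
    exact this.comp_measurePreserving hmp
  have hyc : Continuous fun θ : ℝ => y (t + θ).toNNReal :=
    y.continuous.comp (continuous_real_toNNReal.comp (continuous_const.add continuous_id))
  have h2 : MemLp (fun θ : ℝ => y (t + θ).toNNReal) 2 (volume.restrict (Ioo (-τ) 0)) := by
    obtain ⟨C, hC⟩ := (isCompact_Icc (a := -τ) (b := 0)).exists_bound_of_continuousOn
      hyc.continuousOn
    refine MemLp.of_bound hyc.aestronglyMeasurable C ?_
    filter_upwards [ae_restrict_mem measurableSet_Ioo] with θ hθ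
    exact hC θ (Ioo_subset_Icc_self hθ)
  have h3 : MemLp ({θ : ℝ | (t : ℝ) + θ < 0}ᶜ.indicator fun θ : ℝ => y (t + θ).toNNReal) 2
      (volume.restrict (Ioo (-τ) 0)) :=
    h2.indicator (measurableSet_lt (by fun_prop) (by fun_prop)).compl
  refine (memLp_congr_ae ?_).1 ((h1.restrict (Ioo (-τ) 0)).add h3)
  filter_upwards [ae_restrict_mem measurableSet_Ioo] with θ hθ
  by_cases h : (t : ℝ) + θ < 0
  · have hm : (t : ℝ) + θ ∈ Ioo (-τ) 0 := ⟨by linarith [hθ.1, t.coe_nonneg], h⟩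
    simp [trajectory, h, indicator_of_mem hm]
  · have hm : (t : ℝ) + θ ∉ Ioo (-τ) 0 := fun hh => h hh.2
    simp [trajectory, h, hm]

/-- The history segment `y(t + ·)` in `L²(-τ, 0; X)`. -/
def segment {τ : ℝ} (φ : HistorySpace X τ) (y : C(ℝ≥0, X)) (t : ℝ≥0) : HistorySpace X τ :=
  (memLp_trajectory φ y t).toLp _

variable [InnerProductSpace ℂ X] [CompleteSpace X] [NormedAddCommGroup U] [InnerProductSpace ℂ U]

/-- `y ∈ C([0, ∞); X)` is a mild solution of
`y'(t) = A y(t) + E y(t - τ) + B F(y(t), y(t + ·))`, `y(0) = y₀`, `y = φ` on `(-τ, 0)`: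
for all `t ≥ 0`,
`y(t) = S(t) y₀ + ∫₀ᵗ S(t-s) E y(s-τ) ds + ∫₀ᵗ S̃(t-s) B F(y(s), y(s+·)) ds`,
where both Bochner integrals exist, in `X` and in `X₋₁` respectively, and the identity is read in
`X₋₁`, which contains `X`. -/
structure IsMildSolution {S : C0Semigroup X} {A : X →ₗ.[ℂ] X} {ρ₀ : ℝ} (hA : IsGenerator S A)
    (hρ : (ρ₀ : ℂ) ∈ resolventSetOf A) (B : U →L[ℂ] XNegOne A ρ₀) {τ : ℝ} (E : X →L[ℂ] X)
    (F : WithLp 2 (X × HistorySpace X τ) →L[ℂ] U) (y₀ : X) (φ : HistorySpace X τ)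
    (y : C(ℝ≥0, X)) : Prop where
  initial : y 0 = y₀
  delay_integrable : ∀ t : ℝ≥0, IntervalIntegrable
    (fun s : ℝ => S.op (t - s).toNNReal (E (trajectory φ y (s - τ)))) volume 0 t
  feedback_integrable : ∀ t : ℝ≥0, IntervalIntegrable
    (fun s : ℝ => extendedSemigroup hA hρ (t - s).toNNReal
      (B (F (WithLp.toLp 2 (y s.toNNReal, segment φ y s.toNNReal))))) volume 0 t
  eqn : ∀ t : ℝ≥0, toNegOne A ρ₀ (y t) =
    toNegOne A ρ₀ (S.op t y₀ +
      ∫ s in (0 : ℝ)..t, S.op (t - s).toNNReal (E (trajectory φ y (s - τ)))) +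
    ∫ s in (0 : ℝ)..t, extendedSemigroup hA hρ (t - s).toNNReal
      (B (F (WithLp.toLp 2 (y s.toNNReal, segment φ y s.toNNReal))))

end Delay

end DelaySystem

end

/-! Write `R` for the resolvent at `ρ₀` and `b = (ρ₀ I - Ã)⁻¹ B`, a bounded operator from `U` to
`X`. Applying the isometry `(ρ₀ I - Ã)⁻¹` to the mild equation turns it into an identity in `X`,
whose last term is the ordinary convolution `∫₀ᵗ S(t-s) b u(s) ds` with `u = F(y, y(·+θ))`. If this
convolution equals `R Z(t)` for a continuous `Z`, injectivity of `R` cancels `R`, and the mild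
equation becomes a fixed-point equation `y = Γ y` in `C([0, ∞); X)`.

Admissibility supplies `Z` by duality. With `ψ = R* χ` it says that `‖b* S*(·) χ‖` in `L²(0, T)` is
controlled by `‖R* χ‖`, and the semigroup law carries this to every bounded interval. Pairing the
convolution with `χ` then gives a bound by `‖R* χ‖` times the `L²` norm of `u`, which places the
convolution in the range of `R` with the same bound on a preimage
(`exists_eq_of_norm_inner_le_adjoint`, `exists_preimage_inputConv`). Applied to translates of `u`,
the bound also yields continuity of `Z` (`exists_continuous_response`).

The input `u` is continuous because translation is continuous in `L²`. Since the dependence on `y`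
is affine and causal, a large exponential weight makes `Γ` a contraction on each `[0, N]`: the delay
term gains a factor `1 / l` and the feedback term a factor `1 / √l`. -/

namespace DelaySystem

/-! ### Local bounds, joint continuity and convolutions for a `C₀`-semigroup. -/

namespace C0Semigroup

variable {X : Type*} [NormedAddCommGroup X] [InnerProductSpace ℂ X] [CompleteSpace X]

/-- A `C₀`-semigroup is bounded on compact time intervals. -/
theorem exists_bound (S : C0Semigroup X) (N : ℝ≥0) :
    ∃ M : ℝ, 0 ≤ M ∧ ∀ t ≤ N, ‖S.op t‖ ≤ M := by
  obtain ⟨M, hM⟩ := banach_steinhaus (g := fun t : Icc (0 : ℝ≥0) N => S.op t) fun x => by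
    obtain ⟨C, hC⟩ := (isCompact_Icc (a := (0 : ℝ≥0)) (b := N)).exists_bound_of_continuousOn
      (S.continuous_orbit x).continuousOn
    exact ⟨C, fun t => hC t t.2⟩
  exact ⟨M, (norm_nonneg _).trans (hM ⟨0, by simp⟩), fun t ht => hM ⟨t, zero_le, ht⟩⟩

/-- Split `S(r) v` as `S(r)(v - x) + S(r) x`: the local uniform bound handles the first summand,
strong continuity the second. -/
theorem continuous_uncurry (S : C0Semigroup X) :
    Continuous fun p : ℝ≥0 × X => S.op p.1 p.2 := by
  rw [continuous_iff_continuousAt]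
  rintro ⟨t, x⟩
  obtain ⟨M, -, hM⟩ := S.exists_bound (t + 1)
  have h1 : Tendsto (fun p : ℝ≥0 × X => S.op p.1 (p.2 - x)) (𝓝 (t, x)) (𝓝 0) := by
    have h0 : Tendsto (fun p : ℝ≥0 × X => M * ‖p.2 - x‖) (𝓝 (t, x)) (𝓝 0) := by
      have : Continuous fun p : ℝ≥0 × X => M * ‖p.2 - x‖ := by fun_prop
      simpa using this.tendsto (t, x)
    refine squeeze_zero_norm' ?_ h0
    have hlt : ∀ᶠ p : ℝ≥0 × X in 𝓝 (t, x), p.1 < t + 1 :=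
      continuous_fst.continuousAt.eventually (gt_mem_nhds (lt_add_one t))
    filter_upwards [hlt] with p hp
    exact (S.op p.1).le_of_opNorm_le (hM _ hp.le) _
  have h2 : Tendsto (fun p : ℝ≥0 × X => S.op p.1 x) (𝓝 (t, x)) (𝓝 (S.op t x)) :=
    ((S.continuous_orbit x).comp continuous_fst).tendsto (t, x)
  have := h1.add h2
  rw [zero_add] at this
  refine this.congr fun p => ?_
  rw [map_sub, sub_add_cancel]

theorem aestronglyMeasurable_conv (S : C0Semigroup X) {f : ℝ → X} {μ : Measure ℝ}
    (hf : AEStronglyMeasurable f μ) (t : ℝ) :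
    AEStronglyMeasurable (fun s => S.op (t - s).toNNReal (f s)) μ := by
  have h : AEStronglyMeasurable (fun s : ℝ => ((t - s).toNNReal, f s)) μ :=
    (Continuous.aestronglyMeasurable (by fun_prop)).prodMk hf
  exact S.continuous_uncurry.comp_aestronglyMeasurable h

theorem intervalIntegrable_conv (S : C0Semigroup X) {f : ℝ → X} {t : ℝ} (ht : 0 ≤ t)
    (hf : IntervalIntegrable f volume 0 t) :
    IntervalIntegrable (fun s => S.op (t - s).toNNReal (f s)) volume 0 t := by
  obtain ⟨M, -, hM⟩ := S.exists_bound t.toNNReal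
  refine (hf.norm.const_mul M).mono_fun
    (S.aestronglyMeasurable_conv hf.def'.aestronglyMeasurable t) ?_
  rw [uIoc_of_le ht]
  filter_upwards [ae_restrict_mem measurableSet_Ioc] with s hs
  exact ((S.op _).le_of_opNorm_le (hM _ (Real.toNNReal_le_toNNReal (by linarith [hs.1]))) _).trans
    (le_abs_self _)

/-- The convolution of a `C₀`-semigroup with a locally integrable function is continuous. -/
theorem continuous_conv (S : C0Semigroup X) {f : ℝ → X}
    (hf : ∀ a b, IntervalIntegrable f volume a b) :
    Continuous fun t : ℝ≥0 => ∫ s in (0 : ℝ)..t, S.op ((t : ℝ) - s).toNNReal (f s) := by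
  rw [continuous_iff_continuousAt]
  intro t
  -- The time `r` stays below `t + 1` and the integration variable `s` above `-1`, so `r - s < t +
  -- 2`. The margins put both endpoints `0` and `t` in the open interval `(-1, t + 1)`.
  obtain ⟨M, -, hM⟩ := S.exists_bound (t + 2)
  have key := intervalIntegral.continuousAt_parametric_primitive_of_dominated (μ := volume)
    (F := fun (r : ℝ) s => S.op (r - s).toNNReal (f s)) (fun s => M * ‖f s‖) (-1) (t + 1)
    (a₀ := 0) (b₀ := t) (x₀ := t)
    (fun r => S.aestronglyMeasurable_conv (hf (-1) (t + 1)).def'.aestronglyMeasurable r)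
    ?_ ((hf _ _).norm.const_mul M) ?_ ⟨by norm_num, by positivity⟩
    ⟨by linarith [t.coe_nonneg], by linarith⟩ (by simp)
  · exact ContinuousAt.comp (f := fun r : ℝ≥0 => ((r : ℝ), (r : ℝ))) key (by fun_prop)
  · filter_upwards [gt_mem_nhds (lt_add_one (t : ℝ))] with r hr
    rw [uIoc_of_le (by linarith [t.coe_nonneg])]
    filter_upwards [ae_restrict_mem measurableSet_Ioc] with s hs
    refine (S.op _).le_of_opNorm_le (hM _ ?_) _
    rw [Real.toNNReal_le_iff_le_coe]
    push_cast
    linarith [hs.1]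
  · exact Eventually.of_forall fun s =>
      ((S.continuous_orbit (f s)).comp (by fun_prop)).continuousAt

end C0Semigroup

/-! ### Contraction principle on `C([0, ∞); X)` with exponential weights. -/

section FixedPoint

variable {X : Type*} [NormedAddCommGroup X] [CompleteSpace X]

/-- A self-map of `C([0, ∞); X)` which on each interval `[0, N]` contracts some exponentially
weighted uniform distance has exactly one fixed point. -/
theorem existsUnique_fixedPoint_of_weighted_contraction (Γ : C(ℝ≥0, X) → C(ℝ≥0, X))
    (hΓ : ∀ N : ℝ≥0, ∃ l : ℝ, 0 ≤ l ∧ ∀ (y z : C(ℝ≥0, X)) (D : ℝ), 0 ≤ D →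
      (∀ t ≤ N, ‖y t - z t‖ ≤ D * Real.exp (l * t)) →
      ∀ t ≤ N, ‖Γ y t - Γ z t‖ ≤ D / 2 * Real.exp (l * t)) :
    ∃! y, Γ y = y := by
  have hbound : ∀ (N : ℝ≥0) (l : ℝ), 0 ≤ l → ∀ y z : C(ℝ≥0, X), ∃ D : ℝ, 0 ≤ D ∧
      ∀ t ≤ N, ‖y t - z t‖ ≤ D * Real.exp (l * t) := by
    intro N l hl y z
    obtain ⟨C, hC⟩ := (isCompact_Icc (a := (0 : ℝ≥0)) (b := N)).exists_bound_of_continuousOn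
      (y.continuous.sub z.continuous).continuousOn
    have hC0 : 0 ≤ C := (norm_nonneg _).trans (hC 0 (by simp))
    refine ⟨C, hC0, fun t ht => (hC t ⟨zero_le, ht⟩).trans ?_⟩
    exact le_mul_of_one_le_right hC0 (Real.one_le_exp (by positivity))
  have hpow : Tendsto (fun n : ℕ => (1 / 2 : ℝ) ^ n) atTop (𝓝 0) :=
    tendsto_pow_atTop_nhds_zero_of_lt_one (by norm_num) (by norm_num)
  have huniq : ∀ y z, Γ y = y → Γ z = z → y = z := by
    intro y z hy hz
    ext N
    obtain ⟨l, hl, h⟩ := hΓ N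
    obtain ⟨D, hD, hD'⟩ := hbound N l hl y z
    -- Both functions are fixed, so each application of the contraction halves the same weighted
    -- bound.
    have hn : ∀ n : ℕ, ∀ t ≤ N, ‖y t - z t‖ ≤ D * (1 / 2) ^ n * Real.exp (l * t) := by
      intro n
      induction n with
      | zero => simpa using hD'
      | succ n ih =>
        intro t ht
        have := h y z _ (by positivity) ih t ht
        rw [hy, hz] at this
        refine this.trans (le_of_eq ?_)
        ring
    have hlim : Tendsto (fun n : ℕ => D * (1 / 2) ^ n * Real.exp (l * N)) atTop (𝓝 0) := by
      simpa using (hpow.const_mul D).mul_const (Real.exp (l * N))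
    have := ge_of_tendsto' hlim fun n => hn n N le_rfl
    exact sub_eq_zero.1 (norm_le_zero_iff.1 this)
  set Y : ℕ → C(ℝ≥0, X) := fun n => Γ^[n] 0 with hY
  have hYs : ∀ n, Y (n + 1) = Γ (Y n) := fun n => Function.iterate_succ_apply' Γ n 0
  have hstep : ∀ N : ℝ≥0, ∃ D : ℝ, 0 ≤ D ∧ ∀ t ≤ N, ∀ n,
      dist (Y n t) (Y (n + 1) t) ≤ D * (1 / 2) ^ n := by
    intro N
    obtain ⟨l, hl, h⟩ := hΓ N
    obtain ⟨D, hD, hD'⟩ := hbound N l hl (Y 0) (Y 1)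
    have hn : ∀ n : ℕ, ∀ t ≤ N,
        ‖Y n t - Y (n + 1) t‖ ≤ D * (1 / 2) ^ n * Real.exp (l * t) := by
      intro n
      induction n with
      | zero => simpa using hD'
      | succ n ih =>
        intro t ht
        have := h _ _ _ (by positivity) ih t ht
        rw [← hYs, ← hYs] at this
        refine this.trans (le_of_eq ?_)
        ring
    refine ⟨D * Real.exp (l * N), by positivity, fun t ht n => ?_⟩
    rw [dist_eq_norm]
    refine (hn n t ht).trans ?_
    -- Freezing the weight at `N` leaves a geometric bound uniform on `[0, N]`; the dependence of
    -- `l` on `N` is then harmless.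
    have : Real.exp (l * t) ≤ Real.exp (l * N) := by gcongr
    calc D * (1 / 2) ^ n * Real.exp (l * t) ≤ D * (1 / 2) ^ n * Real.exp (l * N) := by gcongr
      _ = _ := by ring
  have hlim : ∀ t, ∃ x, Tendsto (fun n => Y n t) atTop (𝓝 x) := by
    intro t
    obtain ⟨D, -, h⟩ := hstep t
    exact cauchySeq_tendsto_of_complete
      (cauchySeq_of_le_geometric (1 / 2) D (by norm_num) (h t le_rfl))
  choose y hy using hlim
  have hconv : ∀ N : ℝ≥0, ∃ D : ℝ, 0 ≤ D ∧ ∀ t ≤ N, ∀ n, dist (Y n t) (y t) ≤ D * (1 / 2) ^ n := by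
    intro N
    obtain ⟨D, hD, h⟩ := hstep N
    refine ⟨2 * D, by positivity, fun t ht n => ?_⟩
    refine (dist_le_of_le_geometric_of_tendsto (1 / 2) D (by norm_num) (h t ht) (hy t) n).trans
      (le_of_eq ?_)
    ring
  have hcont : Continuous y := by
    refine TendstoLocallyUniformly.continuous (F := fun n t => Y n t) (p := atTop) ?_
      (Frequently.of_forall fun n => (Y n).continuous)
    rw [Metric.tendstoLocallyUniformly_iff]
    intro ε hε t
    obtain ⟨D, hD, h⟩ := hconv (t + 1)
    refine ⟨Iio (t + 1), Iio_mem_nhds (lt_add_one t), ?_⟩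
    have : Tendsto (fun n : ℕ => D * (1 / 2 : ℝ) ^ n) atTop (𝓝 0) := by
      simpa using hpow.const_mul D
    filter_upwards [this.eventually (gt_mem_nhds hε)] with n hn s hs
    rw [dist_comm]
    exact (h s (le_of_lt hs) n).trans_lt hn
  have hfix : Γ ⟨y, hcont⟩ = ⟨y, hcont⟩ := by
    ext N
    refine tendsto_nhds_unique (f := fun n => Y (n + 1) N) ?_
      ((hy N).comp (tendsto_add_atTop_nat 1))
    obtain ⟨l, hl, h⟩ := hΓ N
    obtain ⟨D, hD, hD'⟩ := hconv N
    -- The weight is at least `1`, so the uniform bound on `Y n - y` is also a weighted one and the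
    -- contraction applies to it.
    have hn : ∀ n, ‖Y (n + 1) N - Γ ⟨y, hcont⟩ N‖ ≤
        D * (1 / 2) ^ n / 2 * Real.exp (l * N) := by
      intro n
      rw [hYs]
      refine h (Y n) ⟨y, hcont⟩ _ (by positivity) (fun t ht => ?_) N le_rfl
      rw [← dist_eq_norm]
      exact (hD' t ht n).trans
        (le_mul_of_one_le_right (by positivity) (Real.one_le_exp (by positivity)))
    rw [tendsto_iff_norm_sub_tendsto_zero]
    refine squeeze_zero (fun n => norm_nonneg _) hn ?_
    simpa using ((hpow.const_mul D).div_const 2).mul_const (Real.exp (l * N))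
  exact ⟨_, hfix, fun z hz => huniq _ _ hz hfix⟩

end FixedPoint

/-! ### Range membership by duality. -/

/-- A vector whose inner products are controlled by the adjoint of `R` lies in the range of `R`. -/
theorem exists_eq_of_norm_inner_le_adjoint {X : Type*} [NormedAddCommGroup X]
    [InnerProductSpace ℂ X] [CompleteSpace X] (R : X →L[ℂ] X) (Φ : X) {c : ℝ} (hc : 0 ≤ c)
    (h : ∀ χ : X, ‖inner ℂ Φ χ‖ ≤ c * ‖ContinuousLinearMap.adjoint R χ‖) :
    ∃ z : X, R z = Φ ∧ ‖z‖ ≤ c := by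
  set Ra : X →ₗ[ℂ] X := (ContinuousLinearMap.adjoint R).toLinearMap with hRa
  have hker : LinearMap.ker Ra ≤ LinearMap.ker (innerSL ℂ Φ).toLinearMap := by
    intro χ hχ
    have h0 : ContinuousLinearMap.adjoint R χ = 0 := hχ
    have := h χ
    rw [h0, norm_zero, mul_zero] at this
    exact norm_le_zero_iff.1 this
  -- The functional `R* χ ↦ ⟨Φ, χ⟩` on the range of `R*`: well defined by the kernel inclusion and
  -- bounded by `c`. Its Hahn–Banach extension is represented by a vector `z` with `⟨z, R* χ⟩ = ⟨Φ,
  -- χ⟩`, which says `R z = Φ`.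
  set f : LinearMap.range Ra →ₗ[ℂ] ℂ :=
    ((LinearMap.ker Ra).liftQ _ hker).comp Ra.quotKerEquivRange.symm.toLinearMap with hf
  have hfv : ∀ χ : X, f ⟨Ra χ, LinearMap.mem_range_self _ _⟩ = inner ℂ Φ χ := by
    intro χ
    simp only [hf, LinearMap.comp_apply, LinearEquiv.coe_coe]
    rw [LinearMap.quotKerEquivRange_symm_apply_image]
    simp
  obtain ⟨g, hg, hgn⟩ := exists_extension_norm_eq (𝕜 := ℂ) (LinearMap.range Ra)
    (f.mkContinuous c (by
      rintro ⟨_, χ, rfl⟩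
      rw [hfv]
      exact h χ))
  refine ⟨(InnerProductSpace.toDual ℂ X).symm g, ?_, ?_⟩
  · refine ext_inner_right ℂ fun χ => ?_
    rw [← ContinuousLinearMap.adjoint_inner_right, InnerProductSpace.toDual_symm_apply]
    exact (hg ⟨Ra χ, LinearMap.mem_range_self _ _⟩).trans (hfv χ)
  · rw [LinearIsometryEquiv.norm_map, hgn]
    exact LinearMap.mkContinuous_norm_le _ hc _

/-! ### The resolvent and its adjoint. -/

section Resolvent

variable {X : Type*} [NormedAddCommGroup X] [InnerProductSpace ℂ X]

theorem resolventOf_injective {A : X →ₗ.[ℂ] X} {z : ℂ} (hz : z ∈ resolventSetOf A) :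
    Function.Injective (resolventOf A z) := by
  rw [injective_iff_map_eq_zero]
  intro f hf
  obtain ⟨x, hx, hxf⟩ := (isResolventAt_resolventOf hz).1 f
  rw [hf] at hx
  have hx0 : x = 0 := Subtype.ext hx
  rw [← hxf, hx0]
  simp

variable [CompleteSpace X]

/-- This is `R(ρ₀ x - A x) = x` with `R` moved to the other side of the inner product; `ρ₀` is real,
so no conjugate appears. It exhibits `ρ₀ R* χ - χ` as the value of `A*` at `R* χ`. -/
theorem inner_adjoint_resolventOf {A : X →ₗ.[ℂ] X} {ρ₀ : ℝ}
    (hρ : (ρ₀ : ℂ) ∈ resolventSetOf A) (χ : X) (x : A.domain) :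
    inner ℂ ((ρ₀ : ℂ) • ContinuousLinearMap.adjoint (resolventOf A ρ₀) χ - χ) (x : X) =
      inner ℂ (ContinuousLinearMap.adjoint (resolventOf A ρ₀) χ) (A x) := by
  have h := (isResolventAt_resolventOf hρ).2 x
  rw [map_sub, map_smul, sub_eq_iff_eq_add, ← sub_eq_iff_eq_add'] at h
  rw [ContinuousLinearMap.adjoint_inner_left, ← h, inner_sub_left, inner_smul_left,
    Complex.conj_ofReal, ContinuousLinearMap.adjoint_inner_left, inner_sub_right, inner_smul_right]

theorem adjoint_resolventOf_mem {A : X →ₗ.[ℂ] X} {ρ₀ : ℝ}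
    (hρ : (ρ₀ : ℂ) ∈ resolventSetOf A) (χ : X) :
    ContinuousLinearMap.adjoint (resolventOf A ρ₀) χ ∈ A.adjoint.domain :=
  LinearPMap.mem_adjoint_domain_of_exists _ ⟨_, inner_adjoint_resolventOf hρ χ⟩

/-- The adjoint of the resolvent is a right inverse of `ρ₀ I - A*`. -/
theorem smul_sub_adjoint_of_eq_adjoint_resolventOf {S : C0Semigroup X} {A : X →ₗ.[ℂ] X} {ρ₀ : ℝ}
    (hA : IsGenerator S A) (hρ : (ρ₀ : ℂ) ∈ resolventSetOf A) (χ : X) (ψ : A.adjoint.domain)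
    (hψ : (ψ : X) = ContinuousLinearMap.adjoint (resolventOf A ρ₀) χ) :
    (ρ₀ : ℂ) • (ψ : X) - A.adjoint ψ = χ := by
  rw [LinearPMap.adjoint_apply_eq hA.dense_domain ψ
    (x₀ := (ρ₀ : ℂ) • ContinuousLinearMap.adjoint (resolventOf A ρ₀) χ - χ)
    (fun x => by rw [hψ]; exact inner_adjoint_resolventOf hρ χ x), hψ, sub_sub_cancel]

end Resolvent

/-! ### Admissibility in terms of bounded operators, on arbitrary time intervals. -/

section Admissible

variable {X U : Type*} [NormedAddCommGroup X] [InnerProductSpace ℂ X] [CompleteSpace X]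
  [NormedAddCommGroup U] [InnerProductSpace ℂ U] [CompleteSpace U]

theorem adjoint_op_add_apply (S : C0Semigroup X) (s t : ℝ≥0) (χ : X) :
    ContinuousLinearMap.adjoint (S.op (s + t)) χ =
      ContinuousLinearMap.adjoint (S.op s) (ContinuousLinearMap.adjoint (S.op t) χ) := by
  rw [add_comm, S.op_add, ContinuousLinearMap.adjoint_comp]
  rfl

theorem adjoint_resolventOf_op {S : C0Semigroup X} {A : X →ₗ.[ℂ] X} {ρ₀ : ℝ}
    (hA : IsGenerator S A) (hρ : (ρ₀ : ℂ) ∈ resolventSetOf A) (t : ℝ≥0) (χ : X) :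
    ContinuousLinearMap.adjoint (resolventOf A ρ₀) (ContinuousLinearMap.adjoint (S.op t) χ) =
      ContinuousLinearMap.adjoint (S.op t)
        (ContinuousLinearMap.adjoint (resolventOf A ρ₀) χ) := by
  refine ext_inner_right ℂ fun x => ?_
  simp only [ContinuousLinearMap.adjoint_inner_left]
  rw [hA.resolventOf_op hρ]

/-- The bounded operator `(ρ₀ I - Ã)⁻¹ B : U → X`. -/
noncomputable def smoothedControl {A : X →ₗ.[ℂ] X} {ρ₀ : ℝ} (B : U →L[ℂ] XNegOne A ρ₀) : U →L[ℂ] X :=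
  (negOneIsometry A ρ₀).toContinuousLinearMap.comp B

/-- `R*` commutes with `S*(t)` and `ρ₀ I - A*` undoes it. The unbounded observation `B* S*(t)` on
`D(A*)` thereby becomes a bounded expression defined for every `χ` in `X`. -/
theorem controlAdjoint_adjoint_op {S : C0Semigroup X} {A : X →ₗ.[ℂ] X} {ρ₀ : ℝ}
    (hA : IsGenerator S A) (hρ : (ρ₀ : ℂ) ∈ resolventSetOf A) (B : U →L[ℂ] XNegOne A ρ₀)
    (t : ℝ≥0) (χ : X) :
    controlAdjoint B ⟨ContinuousLinearMap.adjoint (S.op t)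
      (ContinuousLinearMap.adjoint (resolventOf A ρ₀) χ),
      hA.adjoint_op_mem t ⟨_, adjoint_resolventOf_mem hρ χ⟩⟩ =
    ContinuousLinearMap.adjoint (smoothedControl B) (ContinuousLinearMap.adjoint (S.op t) χ) := by
  rw [controlAdjoint, smul_sub_adjoint_of_eq_adjoint_resolventOf hA hρ
    (ContinuousLinearMap.adjoint (S.op t) χ) _ (adjoint_resolventOf_op hA hρ t χ).symm]
  rfl

/-- Admissibility on some interval implies admissibility on every bounded interval; here it is
stated after the substitution `ψ = (ρ₀ I - A*)⁻¹ χ`. -/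
theorem IsAdmissible.lintegral_le {S : C0Semigroup X} {A : X →ₗ.[ℂ] X} {ρ₀ : ℝ}
    {hA : IsGenerator S A} {B : U →L[ℂ] XNegOne A ρ₀} (hB : IsAdmissible hA B)
    (hρ : (ρ₀ : ℂ) ∈ resolventSetOf A) (N : ℝ) :
    ∃ K : ℝ, 0 ≤ K ∧ ∀ χ : X,
      ∫⁻ t in Ioo 0 N, ‖ContinuousLinearMap.adjoint (smoothedControl B)
        (ContinuousLinearMap.adjoint (S.op t.toNNReal) χ)‖ₑ ^ 2 ≤
      ENNReal.ofReal (K * ‖ContinuousLinearMap.adjoint (resolventOf A ρ₀) χ‖ ^ 2) := by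
  obtain ⟨T, hT, C, hC, h⟩ := hB
  have hT' : ∀ χ : X, ∫⁻ t in Ioo 0 T, ‖ContinuousLinearMap.adjoint (smoothedControl B)
        (ContinuousLinearMap.adjoint (S.op t.toNNReal) χ)‖ₑ ^ 2 ≤
      ENNReal.ofReal (C * ‖ContinuousLinearMap.adjoint (resolventOf A ρ₀) χ‖ ^ 2) := by
    intro χ
    have := h ⟨_, adjoint_resolventOf_mem hρ χ⟩
    simpa only [controlAdjoint_adjoint_op hA hρ] using this
  have hstep : ∀ n : ℕ, ∃ K : ℝ, 0 ≤ K ∧ ∀ χ : X,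
      ∫⁻ t in Ioo 0 (n * T), ‖ContinuousLinearMap.adjoint (smoothedControl B)
        (ContinuousLinearMap.adjoint (S.op t.toNNReal) χ)‖ₑ ^ 2 ≤
      ENNReal.ofReal (K * ‖ContinuousLinearMap.adjoint (resolventOf A ρ₀) χ‖ ^ 2) := by
    intro n
    induction n with
    | zero => exact ⟨0, le_rfl, fun χ => by simp⟩
    | succ n ih =>
      obtain ⟨K, hK, hn⟩ := ih
      set M : ℝ := ‖ContinuousLinearMap.adjoint (S.op T.toNNReal)‖ with hM
      -- The piece on `(0, T)` costs `C`. The rest, shifted by `T`, is the integral on `(0, nT)` for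
      -- `S*(T) χ`, and `R* S*(T) χ = S*(T) R* χ` costs the factor `M ^ 2`.
      refine ⟨C + K * M ^ 2, by positivity, fun χ => ?_⟩
      set w : ℝ → ℝ≥0∞ := fun t => ‖ContinuousLinearMap.adjoint (smoothedControl B)
        (ContinuousLinearMap.adjoint (S.op t.toNNReal) χ)‖ₑ ^ 2 with hw
      have hnT : (0 : ℝ) ≤ n * T := by positivity
      have hsub : Ioo 0 ((n + 1 : ℕ) * T) ⊆ Ioc 0 T ∪ Ioo T ((n + 1 : ℕ) * T) := by
        intro t ht
        rcases le_or_gt t T with h1 | h1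
        · exact Or.inl ⟨ht.1, h1⟩
        · exact Or.inr ⟨h1, ht.2⟩
      have hshift : ∫⁻ t in Ioo T ((n + 1 : ℕ) * T), w t =
          ∫⁻ t in Ioo 0 (n * T), ‖ContinuousLinearMap.adjoint (smoothedControl B)
            (ContinuousLinearMap.adjoint (S.op t.toNNReal)
              (ContinuousLinearMap.adjoint (S.op T.toNNReal) χ))‖ₑ ^ 2 := by
        have e : (fun t : ℝ => t + T) ⁻¹' Ioo T ((n + 1 : ℕ) * T) = Ioo 0 (n * T) := by
          ext t
          simp only [mem_preimage, mem_Ioo]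
          push_cast
          constructor <;> rintro ⟨h1, h2⟩ <;> constructor <;> linarith
        rw [← (measurePreserving_add_right volume T).setLIntegral_comp_preimage_emb
          (measurableEmbedding_addRight T), e]
        refine setLIntegral_congr_fun measurableSet_Ioo fun t ht => ?_
        simp only [hw]
        rw [Real.toNNReal_add ht.1.le hT.le, adjoint_op_add_apply]
      calc ∫⁻ t in Ioo 0 ((n + 1 : ℕ) * T), w t
          ≤ ∫⁻ t in Ioc 0 T ∪ Ioo T ((n + 1 : ℕ) * T), w t := lintegral_mono_set hsub
        _ ≤ (∫⁻ t in Ioc 0 T, w t) + ∫⁻ t in Ioo T ((n + 1 : ℕ) * T), w t :=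
          lintegral_union_le _ _ _
        _ ≤ ENNReal.ofReal (C * ‖ContinuousLinearMap.adjoint (resolventOf A ρ₀) χ‖ ^ 2) +
            ENNReal.ofReal (K * (M * ‖ContinuousLinearMap.adjoint (resolventOf A ρ₀) χ‖) ^ 2) := by
          gcongr
          · rw [setLIntegral_congr Ioo_ae_eq_Ioc.symm]
            exact hT' χ
          · rw [hshift]
            refine (hn _).trans ?_
            rw [adjoint_resolventOf_op hA hρ]
            gcongr
            exact ContinuousLinearMap.le_opNorm _ _
        _ = _ := by
          rw [← ENNReal.ofReal_add (by positivity) (by positivity)]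
          congr 1
          ring
  obtain ⟨n, hn⟩ := exists_nat_ge (N / T)
  obtain ⟨K, hK, h'⟩ := hstep n
  refine ⟨K, hK, fun χ => le_trans (lintegral_mono_set (Ioo_subset_Ioo_right ?_)) (h' χ)⟩
  rwa [div_le_iff₀ hT] at hn

end Admissible

/-! ### Lifting the input convolution through the resolvent. -/

section Response

variable {X U : Type*} [NormedAddCommGroup X] [InnerProductSpace ℂ X] [CompleteSpace X]
  [NormedAddCommGroup U] [InnerProductSpace ℂ U]

/-- The convolution `∫₀ᵗ S(t-s) b u(s) ds`. -/
noncomputable def inputConv (S : C0Semigroup X) (b : U →L[ℂ] X) (u : ℝ → U) (t : ℝ) : X :=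
  ∫ s in (0 : ℝ)..t, S.op (t - s).toNNReal (b (u s))

theorem intervalIntegrable_inputConv (S : C0Semigroup X) (b : U →L[ℂ] X) {u : ℝ → U}
    (hu : Continuous u) (t a c : ℝ) :
    IntervalIntegrable (fun s => S.op (t - s).toNNReal (b (u s))) volume a c := by
  refine Continuous.intervalIntegrable ?_ _ _
  have : Continuous fun s : ℝ => ((t - s).toNNReal, b (u s)) := by fun_prop
  exact S.continuous_uncurry.comp this

theorem inputConv_sub (S : C0Semigroup X) (b : U →L[ℂ] X) {u v : ℝ → U}
    (hu : Continuous u) (hv : Continuous v) (t : ℝ) :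
    inputConv S b (fun s => u s - v s) t = inputConv S b u t - inputConv S b v t := by
  simp only [inputConv, map_sub]
  exact intervalIntegral.integral_sub (intervalIntegrable_inputConv S b hu _ _ _)
    (intervalIntegrable_inputConv S b hv _ _ _)

/-- Splitting the convolution at time `t + h` after the first `h` units of time. -/
theorem inputConv_add (S : C0Semigroup X) (b : U →L[ℂ] X) {u : ℝ → U}
    (hu : Continuous u) {t h : ℝ} (ht : 0 ≤ t) (hh : 0 ≤ h) :
    inputConv S b u (t + h) =
      S.op t.toNNReal (inputConv S b u h) + inputConv S b (fun s => u (s + h)) t := by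
  rw [inputConv, ← intervalIntegral.integral_add_adjacent_intervals (b := h)
    (intervalIntegrable_inputConv S b hu _ _ _) (intervalIntegrable_inputConv S b hu _ _ _)]
  congr 1
  · rw [inputConv, ← ContinuousLinearMap.intervalIntegral_comp_comm _
      (intervalIntegrable_inputConv S b hu _ _ _)]
    refine intervalIntegral.integral_congr fun s hs => ?_
    rw [uIcc_of_le hh] at hs
    rw [show t + h - s = t + (h - s) by ring, Real.toNNReal_add ht (by linarith [hs.2]), S.op_add]
    rfl
  · rw [inputConv]
    have := intervalIntegral.integral_comp_add_right (a := 0) (b := t)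
      (fun s => S.op (t + h - s).toNNReal (b (u s))) h
    rw [zero_add] at this
    rw [← this]
    refine intervalIntegral.integral_congr fun s _ => ?_
    rw [show t + h - (s + h) = t - s by ring]

variable [CompleteSpace U]

/-- Move `S(t-s) b` onto `χ` and use `2|⟨v, u⟩| ≤ ‖v‖² + ‖u‖²` under the integral. In this additive
form only `‖u‖²` has to be measurable, not the dual orbit; scaling `χ` later recovers the product
form. -/
theorem two_mul_norm_inner_inputConv_le (S : C0Semigroup X) (b : U →L[ℂ] X) {u : ℝ → U}
    (hu : Continuous u) {t L : ℝ} (ht : 0 ≤ t) (hL : 0 ≤ L) (χ : X)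
    (hχ : ∫⁻ s in Ioo 0 t, ‖ContinuousLinearMap.adjoint b
        (ContinuousLinearMap.adjoint (S.op s.toNNReal) χ)‖ₑ ^ 2 ≤ ENNReal.ofReal L) :
    2 * ‖inner ℂ χ (inputConv S b u t)‖ ≤ L + ∫ s in (0 : ℝ)..t, ‖u s‖ ^ 2 := by
  have hIoc : ∫⁻ s in Ioc 0 t, ‖ContinuousLinearMap.adjoint b
      (ContinuousLinearMap.adjoint (S.op (t - s).toNNReal) χ)‖ₑ ^ 2 ≤ ENNReal.ofReal L := by
    have e : (fun s : ℝ => t - s) ⁻¹' Ioo 0 t = Ioo 0 t := by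
      ext s
      simp only [mem_preimage, mem_Ioo]
      constructor <;> rintro ⟨h1, h2⟩ <;> constructor <;> linarith
    have hmp := (Measure.measurePreserving_sub_left volume t).setLIntegral_comp_preimage_emb
      (MeasurableEquiv.subLeft t).measurableEmbedding
      (fun s : ℝ => ‖ContinuousLinearMap.adjoint b
        (ContinuousLinearMap.adjoint (S.op s.toNNReal) χ)‖ₑ ^ 2) (Ioo 0 t)
    rw [e] at hmp
    rw [setLIntegral_congr Ioo_ae_eq_Ioc.symm, hmp]
    exact hχ
  have hint : IntervalIntegrable (fun s => ‖u s‖ ^ 2) volume 0 t :=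
    Continuous.intervalIntegrable (by fun_prop) _ _
  have hu2 : ∫⁻ s in Ioc 0 t, ‖u s‖ₑ ^ 2 = ENNReal.ofReal (∫ s in (0 : ℝ)..t, ‖u s‖ ^ 2) := by
    rw [intervalIntegral.integral_of_le ht, ofReal_integral_eq_lintegral_ofReal
      ((intervalIntegrable_iff_integrableOn_Ioc_of_le ht).1 hint)
      (Eventually.of_forall fun _ => by positivity)]
    refine lintegral_congr fun s => ?_
    rw [← ofReal_norm, ENNReal.ofReal_pow (norm_nonneg _)]
  have hI0 : 0 ≤ ∫ s in (0 : ℝ)..t, ‖u s‖ ^ 2 :=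
    intervalIntegral.integral_nonneg ht fun _ _ => by positivity
  have hinner : inner ℂ χ (inputConv S b u t) =
      ∫ s in Ioc 0 t, inner ℂ χ (S.op (t - s).toNNReal (b (u s))) := by
    rw [inputConv, intervalIntegral.integral_of_le ht, ← integral_inner]
    exact (intervalIntegrable_iff_integrableOn_Ioc_of_le ht).1
      (intervalIntegrable_inputConv S b hu _ _ _)
  have hum : Measurable fun s => ‖u s‖ₑ ^ 2 :=
    Measurable.pow_const (f := fun s => ‖u s‖ₑ) (continuous_enorm.comp hu).measurable 2
  have hle : 2 * ‖inner ℂ χ (inputConv S b u t)‖ₑ ≤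
      ENNReal.ofReal (L + ∫ s in (0 : ℝ)..t, ‖u s‖ ^ 2) := by
    rw [ENNReal.ofReal_add hL hI0, ← hu2]
    refine le_trans ?_ (add_le_add hIoc le_rfl)
    rw [← lintegral_add_right _ hum, hinner]
    calc 2 * ‖∫ s in Ioc 0 t, inner ℂ χ (S.op (t - s).toNNReal (b (u s)))‖ₑ
        ≤ 2 * ∫⁻ s in Ioc 0 t, ‖inner ℂ χ (S.op (t - s).toNNReal (b (u s)))‖ₑ := by
          gcongr
          exact enorm_integral_le_lintegral_enorm _
      _ = ∫⁻ s in Ioc 0 t, 2 * ‖inner ℂ χ (S.op (t - s).toNNReal (b (u s)))‖ₑ :=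
          (lintegral_const_mul' _ _ (by norm_num)).symm
      _ ≤ _ := by
          refine lintegral_mono fun s => ?_
          simp only
          set v := ContinuousLinearMap.adjoint b
            (ContinuousLinearMap.adjoint (S.op (t - s).toNNReal) χ) with hv
          have e1 : inner ℂ χ (S.op (t - s).toNNReal (b (u s))) = inner ℂ v (u s) := by
            rw [hv, ContinuousLinearMap.adjoint_inner_left, ContinuousLinearMap.adjoint_inner_left]
          have e2 : 2 * ‖inner ℂ v (u s)‖ ≤ ‖v‖ ^ 2 + ‖u s‖ ^ 2 := by
            nlinarith [norm_inner_le_norm (𝕜 := ℂ) v (u s), sq_nonneg (‖v‖ - ‖u s‖)]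
          rw [e1]
          simp only [← ofReal_norm]
          rw [← ENNReal.ofReal_pow (norm_nonneg _), ← ENNReal.ofReal_pow (norm_nonneg _),
            ← ENNReal.ofReal_add (by positivity) (by positivity),
            show (2 : ℝ≥0∞) = ENNReal.ofReal 2 by simp, ← ENNReal.ofReal_mul (by norm_num)]
          exact ENNReal.ofReal_le_ofReal e2
  rw [← ofReal_norm, show (2 : ℝ≥0∞) = ENNReal.ofReal 2 by simp,
    ← ENNReal.ofReal_mul (by norm_num)] at hle
  exact (ENNReal.ofReal_le_ofReal_iff (by positivity)).1 hle

/-- The input-to-state estimate: `∫₀ᵗ S(t-s) b u(s) ds` lies in the range of `R`, with a preimage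
controlled by the `L²` norm of `u`. -/
theorem exists_preimage_inputConv (S : C0Semigroup X) (R : X →L[ℂ] X) (b : U →L[ℂ] X)
    {N K : ℝ} (hK : 0 ≤ K)
    (h : ∀ χ : X, ∫⁻ s in Ioo 0 N, ‖ContinuousLinearMap.adjoint b
        (ContinuousLinearMap.adjoint (S.op s.toNNReal) χ)‖ₑ ^ 2 ≤
      ENNReal.ofReal (K * ‖ContinuousLinearMap.adjoint R χ‖ ^ 2))
    {u : ℝ → U} (hu : Continuous u) {t : ℝ} (ht : 0 ≤ t) (htN : t ≤ N) :
    ∃ z : X, R z = inputConv S b u t ∧ ‖z‖ ≤ √(K * ∫ s in (0 : ℝ)..t, ‖u s‖ ^ 2) := by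
  have hI0 : 0 ≤ ∫ s in (0 : ℝ)..t, ‖u s‖ ^ 2 :=
    intervalIntegral.integral_nonneg ht fun _ _ => by positivity
  refine exists_eq_of_norm_inner_le_adjoint R _ (Real.sqrt_nonneg _) fun χ => ?_
  set I := ∫ s in (0 : ℝ)..t, ‖u s‖ ^ 2 with hI
  set p := ‖inner ℂ χ (inputConv S b u t)‖ with hp
  set q := ‖ContinuousLinearMap.adjoint R χ‖ with hq
  -- Testing with `c χ` for every real `c` gives a nonnegative quadratic; its discriminant yields
  -- `p² ≤ K q² I`, the Cauchy–Schwarz form of the estimate.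
  have key : ∀ c : ℝ, 0 ≤ K * q ^ 2 * (c * c) + (-(2 * p)) * c + I := by
    intro c
    have h1 := two_mul_norm_inner_inputConv_le S b hu ht (by positivity) ((c : ℂ) • χ)
      ((lintegral_mono_set (Ioo_subset_Ioo_right htN)).trans (h ((c : ℂ) • χ)))
    rw [map_smul, norm_smul, inner_smul_left, norm_mul, Complex.conj_ofReal, Complex.norm_real,
      ← hp, ← hq, ← hI, Real.norm_eq_abs, mul_pow, sq_abs] at h1
    have h2 : c * p ≤ |c| * p := by
      gcongr
      exact le_abs_self c
    nlinarith
  have hd := discrim_le_zero key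
  rw [discrim] at hd
  rw [norm_inner_symm, ← hp]
  refine abs_le_of_sq_le_sq' ?_ (by positivity) |>.2
  rw [mul_pow, Real.sq_sqrt (by positivity)]
  nlinarith

/-- The preimage under an injective `R` of the convolution depends continuously on time. -/
theorem exists_continuous_response (S : C0Semigroup X) (R : X →L[ℂ] X) (b : U →L[ℂ] X)
    (hR : Function.Injective R) (hRS : ∀ t f, R (S.op t f) = S.op t (R f))
    (h : ∀ N : ℝ, ∃ K : ℝ, 0 ≤ K ∧ ∀ χ : X, ∫⁻ s in Ioo 0 N, ‖ContinuousLinearMap.adjoint b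
        (ContinuousLinearMap.adjoint (S.op s.toNNReal) χ)‖ₑ ^ 2 ≤
      ENNReal.ofReal (K * ‖ContinuousLinearMap.adjoint R χ‖ ^ 2))
    {u : ℝ → U} (hu : Continuous u) :
    ∃ Z : C(ℝ≥0, X), ∀ t : ℝ≥0, R (Z t) = inputConv S b u t := by
  have hex : ∀ t : ℝ≥0, ∃ z : X, R z = inputConv S b u t := by
    intro t
    obtain ⟨K, hK, hK'⟩ := h t
    obtain ⟨z, hz, -⟩ := exists_preimage_inputConv S R b hK hK' hu t.coe_nonneg le_rfl
    exact ⟨z, hz⟩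
  choose Z hZ using hex
  refine ⟨⟨Z, ?_⟩, hZ⟩
  rw [continuous_iff_continuousAt]
  intro t₀
  set N : ℝ≥0 := t₀ + 1 with hN
  obtain ⟨K, hK, hK'⟩ := h N
  obtain ⟨M, hM0, hM⟩ := S.exists_bound N
  set g : ℝ → ℝ := fun r => ∫ s in (0 : ℝ)..N, ‖u (s + r) - u s‖ ^ 2 with hg
  set k : ℝ → ℝ := fun r => ∫ s in (0 : ℝ)..r, ‖u s‖ ^ 2 with hk
  have hgc : Continuous g :=
    intervalIntegral.continuous_parametric_intervalIntegral_of_continuous'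
      (f := fun r s => ‖u (s + r) - u s‖ ^ 2)
      (by simp only [Function.uncurry_def]; fun_prop) 0 N
  have hkc : Continuous k :=
    intervalIntegral.continuous_primitive
      (fun _ _ => Continuous.intervalIntegrable (by fun_prop) _ _) 0
  -- A modulus of continuity: `k` measures the input on the first `r` units of time, whose response
  -- `S(t)` then transports; `g` measures the change of the input under a shift by `r`. Integrating
  -- up to `N` in `g` makes it independent of `t`.
  set ω : ℝ → ℝ := fun r => M * √(K * k r) + √(K * g r) with hω
  have hωc : Continuous ω := by fun_prop
  have hω0 : ω 0 = 0 := by simp [hω, hk, hg]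
  have hmod : ∀ t r : ℝ≥0, t + r ≤ N → ‖Z (t + r) - Z t‖ ≤ ω r := by
    intro t r htr
    have htN : t ≤ N := le_self_add.trans htr
    have hrN : r ≤ N := le_add_self.trans htr
    have hus : Continuous fun s => u (s + r) := by fun_prop
    obtain ⟨z₁, hz₁, hn₁⟩ := exists_preimage_inputConv S R b hK hK' hu r.coe_nonneg
      (NNReal.coe_le_coe.2 hrN)
    obtain ⟨z₂, hz₂, hn₂⟩ := exists_preimage_inputConv S R b hK hK'
      (u := fun s => u (s + r) - u s) (by fun_prop) t.coe_nonneg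
      (NNReal.coe_le_coe.2 htN)
    have e : Z (t + r) - Z t = S.op t z₁ + z₂ := by
      apply hR
      rw [map_sub, hZ, hZ, map_add, hRS, hz₁, hz₂, inputConv_sub S b hus hu, NNReal.coe_add,
        inputConv_add S b hu t.coe_nonneg r.coe_nonneg, Real.toNNReal_coe]
      abel
    rw [e]
    refine (norm_add_le _ _).trans (add_le_add ?_ (hn₂.trans ?_))
    · exact ((S.op t).le_of_opNorm_le (hM t htN) _).trans (mul_le_mul_of_nonneg_left hn₁ hM0)
    · refine Real.sqrt_le_sqrt (mul_le_mul_of_nonneg_left ?_ hK)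
      exact intervalIntegral.integral_mono_interval le_rfl t.coe_nonneg (NNReal.coe_le_coe.2 htN)
        (Eventually.of_forall fun _ => by positivity)
        (Continuous.intervalIntegrable (by fun_prop) _ _)
  have hmod' : ∀ t ≤ N, ‖Z t - Z t₀‖ ≤ ω (dist t t₀) := by
    intro t ht
    -- As `ω` does not depend on the left endpoint, the one-sided increment estimate gives
    -- continuity from both sides.
    rcases le_total t t₀ with hle | hle
    · obtain ⟨r, rfl⟩ := exists_add_of_le hle
      have := hmod t r (by rw [hN]; exact le_self_add)
      rw [norm_sub_rev]
      simpa [NNReal.dist_eq] using this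
    · obtain ⟨r, rfl⟩ := exists_add_of_le hle
      simpa [NNReal.dist_eq] using hmod t₀ r ht
  rw [ContinuousAt, tendsto_iff_norm_sub_tendsto_zero]
  have hlim : Tendsto (fun t : ℝ≥0 => ω (dist t t₀)) (𝓝 t₀) (𝓝 0) := by
    have : Continuous fun t : ℝ≥0 => ω (dist t t₀) := by fun_prop
    simpa [hω0] using this.tendsto t₀
  refine squeeze_zero' (Eventually.of_forall fun _ => norm_nonneg _) ?_ hlim
  filter_upwards [gt_mem_nhds (lt_add_one t₀)] with t ht
  exact hmod' t (le_of_lt ht)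

end Response

/-! ### Trajectories and history segments. -/

section Segment

variable {X : Type*} [NormedAddCommGroup X]

/-- Translation is continuous in `L²(ℝ)`, also after restriction to a subset. -/
theorem continuous_toLp_translate {s : Set ℝ} {w : ℝ → X} (hw : MemLp w 2 volume)
    (h : ∀ t : ℝ, MemLp (fun θ => w (t + θ)) 2 (volume.restrict s)) :
    Continuous fun t : ℝ => (h t).toLp _ := by
  -- Continuity on the whole line comes from the translation action on `L²`; restricting the measure
  -- only decreases distances.
  have hc : Continuous fun t : ℝ => (DomAddAct.mk t) +ᵥ hw.toLp w := by
    have h1 : Continuous fun t : ℝ => (DomAddAct.mk t, hw.toLp w) :=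
      (DomAddAct.continuous_mk.comp continuous_id).prodMk continuous_const
    have : Fact ((2 : ℝ≥0∞) ≠ ∞) := ⟨by norm_num⟩
    exact continuous_vadd.comp h1
  rw [continuous_iff_continuousAt] at hc ⊢
  intro t₀
  have h0 := hc t₀
  rw [ContinuousAt, tendsto_iff_dist_tendsto_zero] at h0 ⊢
  refine squeeze_zero (fun _ => dist_nonneg) (fun t => ?_) h0
  rw [DomAddAct.mk_vadd_toLp, DomAddAct.mk_vadd_toLp, Lp.dist_def, Lp.dist_def]
  have h1 : eLpNorm (⇑((h t).toLp _) - ⇑((h t₀).toLp _)) 2 (volume.restrict s) =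
      eLpNorm (fun θ => w (t + θ) - w (t₀ + θ)) 2 (volume.restrict s) :=
    eLpNorm_congr_ae ((h t).coeFn_toLp.sub (h t₀).coeFn_toLp)
  have hm : ∀ r : ℝ, MemLp (fun θ => w (r + θ)) 2 volume := fun r =>
    hw.comp_measurePreserving (measurePreserving_add_left volume r)
  have h2 : eLpNorm (⇑((hm t).toLp _) - ⇑((hm t₀).toLp _)) 2 volume =
      eLpNorm (fun θ => w (t + θ) - w (t₀ + θ)) 2 volume :=
    eLpNorm_congr_ae ((hm t).coeFn_toLp.sub (hm t₀).coeFn_toLp)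
  refine ENNReal.toReal_mono ?_ ?_
  · exact ne_of_eq_of_ne h2 ((hm t).sub (hm t₀)).eLpNorm_ne_top
  · exact h1.le.trans ((eLpNorm_mono_measure _ Measure.restrict_le_self).trans h2.ge)

theorem memLp_indicator_trajectory {τ : ℝ} (φ : HistorySpace X τ) (y : C(ℝ≥0, X)) {N : ℝ}
    (hN0 : 0 ≤ N) : MemLp ((Ioo (-τ) N).indicator (trajectory φ y)) 2 volume := by
  have h1 : MemLp ((Ioo (-τ) 0).indicator φ) 2 volume :=
    (memLp_indicator_iff_restrict measurableSet_Ioo).2 (Lp.memLp φ)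
  have hyc : Continuous fun θ : ℝ => y θ.toNNReal := by fun_prop
  have h2 : MemLp ((Ioo (-τ) N ∩ Ici 0).indicator fun θ => y θ.toNNReal) 2 volume := by
    refine (memLp_indicator_iff_restrict (measurableSet_Ioo.inter measurableSet_Ici)).2 ?_
    obtain ⟨C, hC⟩ := (isCompact_Icc (a := -τ) (b := N)).exists_bound_of_continuousOn
      hyc.continuousOn
    have : IsFiniteMeasure (volume.restrict (Ioo (-τ) N ∩ Ici 0)) :=
      isFiniteMeasure_restrict.2
        ((measure_mono inter_subset_left).trans_lt measure_Ioo_lt_top).ne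
    refine MemLp.of_bound hyc.aestronglyMeasurable C ?_
    filter_upwards [ae_restrict_mem (measurableSet_Ioo.inter measurableSet_Ici)] with θ hθ
    exact hC θ (Ioo_subset_Icc_self hθ.1)
  refine (memLp_congr_ae (Eventually.of_forall fun θ => ?_)).1 (h1.add h2)
  simp only [Pi.add_apply, indicator, trajectory, mem_inter_iff, mem_Ioo, mem_Ici]
  by_cases h0 : θ < 0
  · simp [h0, h0.not_ge, h0.trans_le hN0]
  · simp [h0, not_lt.1 h0]

/-- Segments at times `t < t₀ + 1` only see `(-τ, t₀ + 1)`. Cutting the trajectory off there changes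
none of them and produces an `L²` function on the line, whose translates vary continuously. -/
theorem continuous_segment {τ : ℝ} (φ : HistorySpace X τ) (y : C(ℝ≥0, X)) :
    Continuous (segment φ y) := by
  rw [continuous_iff_continuousAt]
  intro t₀
  set N : ℝ := t₀ + 1 with hN
  set w : ℝ → X := (Ioo (-τ) N).indicator (trajectory φ y) with hw
  have hwm : MemLp w 2 volume := memLp_indicator_trajectory φ y (by positivity)
  have hmem : ∀ t : ℝ, MemLp (fun θ => w (t + θ)) 2 (volume.restrict (Ioo (-τ) 0)) := fun t =>
    (hwm.comp_measurePreserving (measurePreserving_add_left volume t)).restrict _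
  have hc := (continuous_toLp_translate hwm hmem).comp NNReal.continuous_coe
  refine (hc.continuousAt (x := t₀)).congr ?_
  filter_upwards [gt_mem_nhds (lt_add_one t₀)] with t ht
  refine (MemLp.toLp_eq_toLp_iff (hmem t) (memLp_trajectory φ y t)).2 ?_
  filter_upwards [ae_restrict_mem measurableSet_Ioo] with θ hθ
  have htN : (t : ℝ) < N := by exact_mod_cast ht
  rw [hw, indicator_of_mem]
  exact ⟨by linarith [hθ.1, t.coe_nonneg], by linarith [hθ.2]⟩

/-- Two segments with the same prehistory are as close as the trajectories. -/
theorem norm_segment_sub_le {τ : ℝ} (hτ : 0 ≤ τ) (φ : HistorySpace X τ) (y z : C(ℝ≥0, X)) {t : ℝ≥0} {C : ℝ}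
    (hC : ∀ s ≤ t, ‖y s - z s‖ ≤ C) :
    ‖segment φ y t - segment φ z t‖ ≤ √τ * C := by
  have hC0 : 0 ≤ C := (norm_nonneg _).trans (hC t le_rfl)
  rw [segment, segment, ← MemLp.toLp_sub, Lp.norm_toLp]
  refine ENNReal.toReal_le_of_le_ofReal (by positivity) ?_
  refine (eLpNorm_le_of_ae_bound (C := C) ?_).trans (le_of_eq ?_)
  · filter_upwards [ae_restrict_mem measurableSet_Ioo] with θ hθ
    simp only [Pi.sub_apply, trajectory]
    split_ifs with hlt
    · simpa using hC0
    · refine hC _ ?_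
      rw [Real.toNNReal_le_iff_le_coe]
      linarith [hθ.2]
  · simp only [Measure.restrict_apply MeasurableSet.univ, univ_inter, Real.volume_Ioo]
    rw [ENNReal.ofReal_mul (Real.sqrt_nonneg _), Real.sqrt_eq_rpow,
      ← ENNReal.ofReal_rpow_of_nonneg hτ (by norm_num)]
    norm_num

/-- The trajectory, cut off at time `-τ`, is locally integrable. -/
theorem intervalIntegrable_trajectory {τ : ℝ} (φ : HistorySpace X τ) (y : C(ℝ≥0, X)) (a b : ℝ) :
    IntervalIntegrable ((Ioi (-τ)).indicator (trajectory φ y)) volume a b := by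
  set N : ℝ := |max a b| + 1 with hN
  have h := ((memLp_indicator_trajectory φ y (N := N) (by positivity)).locallyIntegrable
    (by norm_num)).integrableOn_isCompact (isCompact_uIcc (a := a) (b := b)) |>.intervalIntegrable
  refine h.congr fun s hs => ?_
  have hs' : s < N := by
    have := le_abs_self (max a b)
    rw [uIoc, mem_Ioc] at hs
    change _ ∧ s ≤ max a b at hs
    linarith [hs.2]
  simp only [indicator, mem_Ioo, mem_Ioi, hs', and_true]

/-- The common prehistory cancels, so the weighted bound extends to all negative times. -/
theorem norm_trajectory_sub_le {τ : ℝ} (φ : HistorySpace X τ) (y z : C(ℝ≥0, X)) {N : ℝ≥0}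
    {l D : ℝ} (hD : 0 ≤ D) (h : ∀ t ≤ N, ‖y t - z t‖ ≤ D * Real.exp (l * t))
    {s : ℝ} (hs : s ≤ N) : ‖trajectory φ y s - trajectory φ z s‖ ≤ D * Real.exp (l * s) := by
  unfold trajectory
  split_ifs with h0
  · rw [sub_self, norm_zero]
    positivity
  · have := h s.toNNReal (by rwa [Real.toNNReal_le_iff_le_coe])
    rwa [Real.coe_toNNReal _ (not_lt.1 h0)] at this

end Segment

/-- The source of smallness: integrating the weight gains `1 / l`. -/
theorem integral_exp_mul_le {l : ℝ} (hl : 0 < l) (t : ℝ) :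
    ∫ s in (0 : ℝ)..t, Real.exp (l * s) ≤ Real.exp (l * t) / l := by
  have h : ∀ s ∈ uIcc 0 t, HasDerivAt (fun s => Real.exp (l * s) / l) (Real.exp (l * s)) s := by
    intro s _
    have := (((hasDerivAt_id s).const_mul l).exp).div_const l
    simpa [hl.ne'] using this
  rw [intervalIntegral.integral_eq_sub_of_hasDerivAt h
    (Continuous.intervalIntegrable (by fun_prop) _ _)]
  have : 0 ≤ Real.exp (l * 0) / l := by positivity
  linarith

/-! ### The delay term. -/

section Delay

variable {X : Type*} [NormedAddCommGroup X] [InnerProductSpace ℂ X]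

/-- The representative of `φ` is uncontrolled to the left of `-τ`. The cutoff makes the input
locally integrable on the whole line, as `continuous_conv` requires, and is invisible for `s > 0`.
-/
theorem intervalIntegrable_delayInput {τ : ℝ} (E : X →L[ℂ] X) (φ : HistorySpace X τ)
    (y : C(ℝ≥0, X)) (a b : ℝ) :
    IntervalIntegrable (fun s => E ((Ioi (-τ)).indicator (trajectory φ y) (s - τ))) volume a b := by
  have h : IntervalIntegrable (fun s => (Ioi (-τ)).indicator (trajectory φ y) (s - τ))
      volume a b := by
    simpa using (intervalIntegrable_trajectory φ y (a - τ) (b - τ)).comp_sub_right τ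
  exact ⟨E.integrable_comp h.1, E.integrable_comp h.2⟩

theorem delayInput_eq {τ : ℝ} (E : X →L[ℂ] X) (φ : HistorySpace X τ) (y : C(ℝ≥0, X)) {s : ℝ}
    (hs : 0 < s) :
    E ((Ioi (-τ)).indicator (trajectory φ y) (s - τ)) = E (trajectory φ y (s - τ)) := by
  rw [indicator_of_mem]
  exact mem_Ioi.2 (by linarith)

variable [CompleteSpace X]

theorem intervalIntegrable_delay (S : C0Semigroup X) {τ : ℝ} (E : X →L[ℂ] X)
    (φ : HistorySpace X τ) (y : C(ℝ≥0, X)) (t : ℝ≥0) :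
    IntervalIntegrable (fun s : ℝ => S.op (t - s).toNNReal (E (trajectory φ y (s - τ))))
      volume 0 t := by
  refine (S.intervalIntegrable_conv t.coe_nonneg
    (intervalIntegrable_delayInput E φ y 0 t)).congr fun s hs => ?_
  rw [uIoc_of_le t.coe_nonneg] at hs
  simp only [delayInput_eq E φ y hs.1]

theorem continuous_delay (S : C0Semigroup X) {τ : ℝ} (E : X →L[ℂ] X)
    (φ : HistorySpace X τ) (y : C(ℝ≥0, X)) :
    Continuous fun t : ℝ≥0 =>
      ∫ s in (0 : ℝ)..t, S.op ((t : ℝ) - s).toNNReal (E (trajectory φ y (s - τ))) := by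
  refine (S.continuous_conv (intervalIntegrable_delayInput E φ y)).congr fun t => ?_
  refine intervalIntegral.integral_congr_ae (Eventually.of_forall fun s hs => ?_)
  rw [uIoc_of_le t.coe_nonneg] at hs
  rw [delayInput_eq E φ y hs.1]

theorem norm_delay_sub_le (S : C0Semigroup X) {τ : ℝ} (hτ : 0 ≤ τ) (E : X →L[ℂ] X)
    (φ : HistorySpace X τ) (y z : C(ℝ≥0, X)) {N : ℝ≥0} {M l D : ℝ} (hM : ∀ t ≤ N, ‖S.op t‖ ≤ M)
    (hM0 : 0 ≤ M) (hl : 0 < l) (hD : 0 ≤ D) (h : ∀ t ≤ N, ‖y t - z t‖ ≤ D * Real.exp (l * t))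
    {t : ℝ≥0} (ht : t ≤ N) :
    ‖(∫ s in (0 : ℝ)..t, S.op ((t : ℝ) - s).toNNReal (E (trajectory φ y (s - τ)))) -
      ∫ s in (0 : ℝ)..t, S.op ((t : ℝ) - s).toNNReal (E (trajectory φ z (s - τ)))‖ ≤
      M * ‖E‖ * D * (Real.exp (l * t) / l) := by
  rw [← intervalIntegral.integral_sub (intervalIntegrable_delay S E φ y t)
    (intervalIntegrable_delay S E φ z t)]
  refine (intervalIntegral.norm_integral_le_of_norm_le t.coe_nonneg
    (g := fun s => M * ‖E‖ * D * Real.exp (l * s)) (Eventually.of_forall fun s hs => ?_)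
    (Continuous.intervalIntegrable (by fun_prop) _ _)).trans ?_
  · rw [← map_sub, ← map_sub]
    have hsN : s - τ ≤ N := by linarith [hs.2, NNReal.coe_le_coe.2 ht]
    have h1 := norm_trajectory_sub_le φ y z hD h hsN
    have h2 : Real.exp (l * (s - τ)) ≤ Real.exp (l * s) := by
      gcongr
      linarith
    have h3 : ‖S.op ((t : ℝ) - s).toNNReal‖ ≤ M := by
      refine hM _ (le_trans ?_ ht)
      rw [Real.toNNReal_le_iff_le_coe]
      linarith [hs.1]
    calc _ ≤ M * (‖E‖ * ‖trajectory φ y (s - τ) - trajectory φ z (s - τ)‖) :=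
          ((S.op _).le_of_opNorm_le h3 _).trans
            (mul_le_mul_of_nonneg_left (E.le_opNorm _) hM0)
      _ ≤ M * (‖E‖ * (D * Real.exp (l * s))) := by
          gcongr
          exact h1.trans (by gcongr)
      _ = _ := by ring
  · rw [intervalIntegral.integral_const_mul]
    gcongr
    exact integral_exp_mul_le hl t

end Delay

/-! ### The feedback input and its Lipschitz estimates. -/

section Feedback

variable {X U : Type*} [NormedAddCommGroup X] [InnerProductSpace ℂ X]
  [NormedAddCommGroup U] [InnerProductSpace ℂ U]

/-- The feedback input `s ↦ F(y(s), y(s + ·))`. -/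
noncomputable def feedback {τ : ℝ} (F : WithLp 2 (X × HistorySpace X τ) →L[ℂ] U)
    (φ : HistorySpace X τ) (y : C(ℝ≥0, X)) (s : ℝ) : U :=
  F (WithLp.toLp 2 (y s.toNNReal, segment φ y s.toNNReal))

theorem continuous_feedback {τ : ℝ} (F : WithLp 2 (X × HistorySpace X τ) →L[ℂ] U)
    (φ : HistorySpace X τ) (y : C(ℝ≥0, X)) : Continuous (feedback F φ y) := by
  have h1 : Continuous fun s : ℝ => (y s.toNNReal, segment φ y s.toNNReal) :=
    (y.continuous.comp continuous_real_toNNReal).prodMk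
      ((continuous_segment φ y).comp continuous_real_toNNReal)
  exact F.continuous.comp ((WithLp.prod_continuous_toLp 2 _ _).comp h1)

theorem norm_feedback_sub_le {τ : ℝ} (hτ : 0 ≤ τ) (F : WithLp 2 (X × HistorySpace X τ) →L[ℂ] U)
    (φ : HistorySpace X τ) (y z : C(ℝ≥0, X)) {N : ℝ≥0} {l D : ℝ} (hl : 0 ≤ l) (hD : 0 ≤ D)
    (h : ∀ t ≤ N, ‖y t - z t‖ ≤ D * Real.exp (l * t)) {s : ℝ} (hs0 : 0 ≤ s) (hs : s ≤ N) :
    ‖feedback F φ y s - feedback F φ z s‖ ≤ ‖F‖ * (1 + √τ) * D * Real.exp (l * s) := by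
  lift s to ℝ≥0 using hs0
  have hsN : s ≤ N := hs
  rw [feedback, feedback, ← map_sub, ← WithLp.toLp_sub, Prod.mk_sub_mk, Real.toNNReal_coe]
  have hseg : ‖segment φ y s - segment φ z s‖ ≤ √τ * (D * Real.exp (l * s)) := by
    refine norm_segment_sub_le hτ φ y z fun r hr => (h r (hr.trans hsN)).trans ?_
    gcongr
  have hprod : ∀ (a : X) (b : HistorySpace X τ), ‖WithLp.toLp 2 (a, b)‖ ≤ ‖a‖ + ‖b‖ := by
    intro a b
    rw [WithLp.prod_norm_eq_of_L2]
    refine Real.sqrt_le_iff.2 ⟨by positivity, ?_⟩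
    change ‖a‖ ^ 2 + ‖b‖ ^ 2 ≤ _
    nlinarith [norm_nonneg a, norm_nonneg b]
  calc _ ≤ ‖F‖ * (‖y s - z s‖ + ‖segment φ y s - segment φ z s‖) :=
        (F.le_opNorm _).trans (mul_le_mul_of_nonneg_left (hprod _ _) (norm_nonneg _))
    _ ≤ ‖F‖ * (D * Real.exp (l * s) + √τ * (D * Real.exp (l * s))) := by
        gcongr
        exact h s hsN
    _ = _ := by ring

/-- Squaring doubles the exponent of the weight, hence a gain of `1 / (2 * l)` here and of order `1
/ √l` after the square root in the response estimate. -/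
theorem integral_norm_feedback_sub_sq_le {τ : ℝ} (hτ : 0 ≤ τ)
    (F : WithLp 2 (X × HistorySpace X τ) →L[ℂ] U) (φ : HistorySpace X τ) (y z : C(ℝ≥0, X))
    {N : ℝ≥0} {l D : ℝ} (hl : 0 < l) (hD : 0 ≤ D)
    (h : ∀ t ≤ N, ‖y t - z t‖ ≤ D * Real.exp (l * t)) {t : ℝ≥0} (ht : t ≤ N) :
    ∫ s in (0 : ℝ)..t, ‖feedback F φ y s - feedback F φ z s‖ ^ 2 ≤
      (‖F‖ * (1 + √τ) * D) ^ 2 * (Real.exp (l * t) ^ 2 / (2 * l)) := by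
  have hy := continuous_feedback F φ y
  have hz := continuous_feedback F φ z
  have hexp : ∀ s : ℝ, Real.exp (l * s) ^ 2 = Real.exp (2 * l * s) := by
    intro s
    rw [← Real.exp_nat_mul]
    congr 1
    push_cast
    ring
  calc _ ≤ ∫ s in (0 : ℝ)..t, (‖F‖ * (1 + √τ) * D) ^ 2 * Real.exp (2 * l * s) := by
        refine intervalIntegral.integral_mono_on t.coe_nonneg
          (Continuous.intervalIntegrable (by fun_prop) _ _)
          (Continuous.intervalIntegrable (by fun_prop) _ _) fun s hs => ?_
        rw [← hexp, ← mul_pow]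
        gcongr
        exact norm_feedback_sub_le hτ F φ y z hl.le hD h hs.1
          (hs.2.trans (NNReal.coe_le_coe.2 ht))
    _ ≤ _ := by
        rw [intervalIntegral.integral_const_mul, hexp]
        gcongr
        exact integral_exp_mul_le (by positivity) _

end Feedback

/-! ### Transfer of the convolution from `X₋₁` to `X`. -/

section Extrapolation

variable {X U : Type*} [NormedAddCommGroup X] [InnerProductSpace ℂ X] [CompleteSpace X]
  [NormedAddCommGroup U] [InnerProductSpace ℂ U]
  {S : C0Semigroup X} {A : X →ₗ.[ℂ] X} {ρ₀ : ℝ}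

theorem extendedSemigroup_apply_control (hA : IsGenerator S A)
    (hρ : (ρ₀ : ℂ) ∈ resolventSetOf A) (B : U →L[ℂ] XNegOne A ρ₀) (t : ℝ≥0) (v : U) :
    extendedSemigroup hA hρ t (B v) =
      (negOneEquiv hA hρ).symm (S.op t (smoothedControl B v)) := rfl

theorem negOneEquiv_toNegOne (hA : IsGenerator S A) (hρ : (ρ₀ : ℂ) ∈ resolventSetOf A) (x : X) :
    negOneEquiv hA hρ (toNegOne A ρ₀ x) = resolventOf A ρ₀ x :=
  negOneIsometry_toNegOne A ρ₀ x

theorem intervalIntegrable_extendedSemigroup (hA : IsGenerator S A)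
    (hρ : (ρ₀ : ℂ) ∈ resolventSetOf A) (B : U →L[ℂ] XNegOne A ρ₀) {u : ℝ → U}
    (hu : Continuous u) (t a c : ℝ) :
    IntervalIntegrable (fun s => extendedSemigroup hA hρ (t - s).toNNReal (B (u s)))
      volume a c := by
  refine Continuous.intervalIntegrable ?_ _ _
  simp only [extendedSemigroup_apply_control]
  have : Continuous fun s : ℝ => ((t - s).toNNReal, smoothedControl B (u s)) := by fun_prop
  exact (negOneEquiv hA hρ).symm.continuous.comp (S.continuous_uncurry.comp this)

/-- The resolvent takes the convolution in `X₋₁` to a convolution in `X`. -/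
theorem negOneEquiv_integral (hA : IsGenerator S A)
    (hρ : (ρ₀ : ℂ) ∈ resolventSetOf A) (B : U →L[ℂ] XNegOne A ρ₀) {u : ℝ → U}
    (hu : Continuous u) (t : ℝ) :
    negOneEquiv hA hρ (∫ s in (0 : ℝ)..t, extendedSemigroup hA hρ (t - s).toNNReal (B (u s))) =
      inputConv S (smoothedControl B) u t := by
  have := ContinuousLinearMap.intervalIntegral_comp_comm
    ((negOneEquiv hA hρ).toContinuousLinearEquiv : XNegOne A ρ₀ →L[ℂ] X)
    (intervalIntegrable_extendedSemigroup hA hρ B hu t 0 t)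
  refine this.symm.trans ?_
  rw [inputConv]
  refine intervalIntegral.integral_congr fun s _ => ?_
  exact (negOneEquiv hA hρ).apply_symm_apply _

end Extrapolation

end DelaySystem

theorem proposition5p1
    {X U : Type*}
    [NormedAddCommGroup X] [InnerProductSpace ℂ X] [CompleteSpace X]
    [TopologicalSpace.SeparableSpace X]
    [NormedAddCommGroup U] [InnerProductSpace ℂ U] [CompleteSpace U]
    [TopologicalSpace.SeparableSpace U]
    (S : DelaySystem.C0Semigroup X) (A : X →ₗ.[ℂ] X)
    (hA : DelaySystem.IsGenerator S A) (hS : DelaySystem.ImmediatelyCompact S)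
    (ρ₀ : ℝ) (hρ : (ρ₀ : ℂ) ∈ DelaySystem.resolventSetOf A)
    (B : U →L[ℂ] DelaySystem.XNegOne A ρ₀) (hB : DelaySystem.IsAdmissible hA B)
    (τ : ℝ) (hτ : 0 < τ) (E : X →L[ℂ] X)
    (F : WithLp 2 (X × DelaySystem.HistorySpace X τ) →L[ℂ] U)
    (y₀ : X) (φ : DelaySystem.HistorySpace X τ) :
    ∃! y : C(ℝ≥0, X), DelaySystem.IsMildSolution hA hρ B E F y₀ φ y := by
  open DelaySystem in
  set R := resolventOf A ρ₀ with hRdef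
  set b := smoothedControl B with hb
  have hR : Function.Injective R := resolventOf_injective hρ
  have hadm := hB.lintegral_le hρ
  choose Z hZ using fun y : C(ℝ≥0, X) => exists_continuous_response S R b hR
    (hA.resolventOf_op hρ) hadm (continuous_feedback F φ y)
  set V : C(ℝ≥0, X) → ℝ≥0 → X := fun y t =>
    ∫ s in (0 : ℝ)..t, S.op ((t : ℝ) - s).toNNReal (E (trajectory φ y (s - τ))) with hV
  set Γ : C(ℝ≥0, X) → C(ℝ≥0, X) := fun y =>
    ⟨fun t => S.op t y₀ + V y t + Z y t,
      ((S.continuous_orbit y₀).add (continuous_delay S E φ y)).add (Z y).continuous⟩ with hΓ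
  have hiff : ∀ y, IsMildSolution hA hρ B E F y₀ φ y ↔ Γ y = y := by
    intro y
    have heqn : ∀ t : ℝ≥0, (toNegOne A ρ₀ (y t) = toNegOne A ρ₀ (S.op t y₀ + V y t) +
        ∫ s in (0 : ℝ)..t, extendedSemigroup hA hρ (t - s).toNNReal
          (B (feedback F φ y s))) ↔ Γ y t = y t := by
      intro t
      -- Under the isometry both sides become values of `R`, the convolution being `R (Z y t)`;
      -- injectivity of `R` then removes it.
      rw [← (negOneEquiv hA hρ).injective.eq_iff, map_add, negOneEquiv_toNegOne,
        negOneEquiv_toNegOne, negOneEquiv_integral hA hρ B (continuous_feedback F φ y), ← hZ,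
        ← map_add, hR.eq_iff]
      exact eq_comm
    constructor
    · intro h
      ext t
      exact (heqn t).1 (h.eqn t)
    · intro h
      refine ⟨?_, intervalIntegrable_delay S E φ y, fun t =>
        intervalIntegrable_extendedSemigroup hA hρ B (continuous_feedback F φ y) _ _ _,
        fun t => (heqn t).2 (DFunLike.congr_fun h t)⟩
      have hZ0 : Z y 0 = 0 := hR (by rw [hZ, map_zero]; simp [inputConv])
      rw [← h]
      simp [hΓ, hV, hZ0, S.op_zero]
  simp only [hiff]
  refine existsUnique_fixedPoint_of_weighted_contraction Γ fun N => ?_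
  obtain ⟨M, hM0, hM⟩ := S.exists_bound N
  obtain ⟨K, hK, hK'⟩ := hadm N
  set c : ℝ := ‖F‖ * (1 + √τ) with hc
  -- Each term is to contribute a factor at most `1 / 4`: the delay needs `M ‖E‖ / l ≤ 1 / 4`, the
  -- feedback `K c² / (2 l) ≤ 1 / 16`. The summand `1` keeps `l` positive.
  set l : ℝ := 1 + 4 * (M * ‖E‖) + 8 * (K * c ^ 2) with hl
  have hl0 : 0 < l := by positivity
  refine ⟨l, hl0.le, fun y z D hD h t ht => ?_⟩
  have h1 : ‖V y t - V z t‖ ≤ D / 4 * Real.exp (l * t) := by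
    refine (norm_delay_sub_le S hτ.le E φ y z hM hM0 hl0 hD h ht).trans ?_
    rw [← mul_div_assoc, div_le_iff₀ hl0]
    have : M * ‖E‖ * 4 ≤ l := by
      have : 0 ≤ K * c ^ 2 := by positivity
      linarith
    have hp : 0 ≤ D / 4 * Real.exp (l * t) := by positivity
    nlinarith [mul_le_mul_of_nonneg_left this hp]
  have h2 : ‖Z y t - Z z t‖ ≤ D / 4 * Real.exp (l * t) := by
    have hy := continuous_feedback F φ y
    have hz := continuous_feedback F φ z
    obtain ⟨x, hx, hxn⟩ := exists_preimage_inputConv S R b hK hK' (hy.sub hz) t.coe_nonneg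
      (NNReal.coe_le_coe.2 ht)
    -- The convolution is linear in the input and `R` is injective, so the controlled preimage for
    -- the difference of inputs is the difference of the chosen responses.
    have hxe : Z y t - Z z t = x := by
      apply hR
      rw [map_sub, hZ, hZ, hx]
      exact (inputConv_sub S b hy hz t).symm
    rw [hxe]
    refine hxn.trans (Real.sqrt_le_iff.2 ⟨by positivity, ?_⟩)
    refine (mul_le_mul_of_nonneg_left
      (integral_norm_feedback_sub_sq_le hτ.le F φ y z hl0 hD h ht) hK).trans ?_
    rw [← hc, ← mul_div_assoc, ← mul_div_assoc, div_le_iff₀ (by positivity)]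
    have : K * c ^ 2 * 8 ≤ l := by
      have : 0 ≤ M * ‖E‖ := by positivity
      linarith
    have hp : 0 ≤ D ^ 2 / 8 * Real.exp (l * t) ^ 2 := by positivity
    nlinarith [mul_le_mul_of_nonneg_left this hp]
  have e : Γ y t - Γ z t = (V y t - V z t) + (Z y t - Z z t) := by
    simp only [hΓ, ContinuousMap.coe_mk]
    abel
  rw [e]
  refine (norm_add_le _ _).trans ((add_le_add h1 h2).trans (le_of_eq ?_))
  ring
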